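/- Let $m\ge 1$ be an integer, $c\in(0,\infty)$, and let $(D_N)_{N\ge 1}$ be integers with $D_N/N\to c$ as $N\to\infty$ (for instance $D_N=\lfloor cN\rfloor$). For each $N$ let $X_N\in\mathbb C^N\otimes\mathbb C^m\otimes\mathbb C^m\otimes\mathbb C^{D_N}=\mathcal H_A\otimes\mathcal H_B\otimes\mathcal H_C\otimes\mathcal H_D$ be a Gaussian tensor, i.e. a random tensor whose entries are i.i.d. standard complex Gaussian variables (density $\pi^{-1}e^{-|z|^2}$ on $\mathbb C$). Put $$W_{AB}=[\mathrm{id}\otimes\mathrm{id}\otimes\mathrm{Tr}\otimes\mathrm{Tr}](X_NX_N^*),\qquad W_{AC}=[\mathrm{id}\otimes\mathrm{Tr}\otimes\mathrm{id}\otimes\mathrm{Tr}](X_NX_N^*),$$ both regarded as $mN\times mN$ random matrices by identifying $\mathcal H_B$ and $\mathcal H_C$ with $\mathbb C^m$. For a word $f\in\{AB,AC\}^p$ let $W_f=W_{f(p)}\cdots W_{f(2)}W_{f(1)}$ and $$\mathsf{alt}(f)=|\{a\in\{1,\dots,p\} : f(a)\ne f(a+1)\}|,\qquad f(p+1):=f(1).$$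 For a non-crossing partition $\alpha\in\mathrm{NC}(p)$, with $\#\alpha$ blocks, let $\mathsf{alt}(f,\alpha)=|\{a : f(a)\neq f(\alpha(a))\}|$, where $\alpha$ is seen as the permutation of $\{1,\dots,p\}$ whose cycles are the blocks of $\alpha$ in their cyclic order. Theorem. As $N\to\infty$, the pairs of random matrices $\bigl((mN)^{-1}W_{AB},(mN)^{-1}W_{AC}\bigr)$ converge in distribution to a pair $(x_{AB},x_{AC})$ of elements of some non-commutative probability space $(\mathcal A,\varphi)$ (a unital complex algebra with a unital linear functional): for every $p$ and every word $f\in\{AB,AC\}^p$ the moment $$\mathbb E\,(mN)^{-1}\mathrm{Tr}\bigl[(mN)^{-1}W_{f(1)}\cdots (mN)^{-1}W_{f(p)}\bigr]$$ exists and converges to $\varphi(x_{f(1)}\cdots x_{f(p)})$. The free cumulants of the limit are $$\kappa(x_{f(1)},\dots,x_{f(p)})=c\,m^{-\mathsf{alt}(f)}\qquad\text{for all } p\ge 1,\ f\in\{AB,AC\}^p.$$ Equivalently, for every word $f\in\{AB,AC\}^p$, $$\mathbb E\,\mathrm{Tr}\,W_f=(1+o(1))\,(mN)^{p+1}\sum_{\alpha\in\mathrm{NC}(p)}c^{\#\alpha}\,m^{-\mathsf{alt}(f,\alpha)}\qquad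 (N\to\infty).$$ -/

import Mathlib

open MeasureTheory ProbabilityTheory Filter Topology Asymptotics

noncomputable section

namespace WishartTensor

/-! ## Gaussian tensors and their marginals -/

/-- The standard complex Gaussian law, with density `π⁻¹ exp (-|z|²)` with respect to
Lebesgue measure on `ℂ`. -/
def stdComplexGaussian : Measure ℂ :=
  (volume : Measure ℂ).withDensity fun z => ENNReal.ofReal (Real.pi⁻¹ * Real.exp (-‖z‖ ^ 2))

/-- A random tensor, given by its coordinates `X k`, is a (standard) Gaussian tensor if its
coordinates are i.i.d. standard complex Gaussian random variables. -/
structure IsGaussianTensor {κ Ω : Type*} [MeasurableSpace Ω] (X : κ → Ω → ℂ) (μ : Measure Ω) :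
    Prop where
  indep : iIndepFun X μ
  law : ∀ k, HasLaw (X k) stdComplexGaussian μ

section Marginals

variable {A B C D : Type*}

/-- The matrix `X X*` of a tensor `X ∈ ℂ^A ⊗ ℂ^B ⊗ ℂ^C ⊗ ℂ^D`. -/
def outer (X : A × B × C × D → ℂ) : Matrix (A × B × C × D) (A × B × C × D) ℂ :=
  Matrix.vecMulVec X (star X)

/-- `[id ⊗ id ⊗ Tr ⊗ Tr](X X*)`. -/
def marginalAB [Fintype C] [Fintype D] (X : A × B × C × D → ℂ) : Matrix (A × B) (A × B) ℂ :=
  Matrix.of fun i j => ∑ k : C, ∑ l : D, outer X (i.1, i.2, k, l) (j.1, j.2, k, l)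

/-- `[id ⊗ Tr ⊗ id ⊗ Tr](X X*)`. -/
def marginalAC [Fintype B] [Fintype D] (X : A × B × C × D → ℂ) : Matrix (A × C) (A × C) ℂ :=
  Matrix.of fun i j => ∑ k : B, ∑ l : D, outer X (i.1, k, i.2, l) (j.1, k, j.2, l)

end Marginals

/-- The two letters. -/
inductive Letter : Type
  | AB : Letter
  | AC : Letter
  deriving DecidableEq

/-- The marginal `W_AB` or `W_AC`, the spaces `B` and `C` being identified. -/
def W {A B D : Type*} [Fintype B] [Fintype D] (X : A × B × B × D → ℂ) :
    Letter → Matrix (A × B) (A × B) ℂ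
  | Letter.AB => marginalAB X
  | Letter.AC => marginalAC X

/-- The product `W_f = W_{f(p)} ⋯ W_{f(2)} W_{f(1)}` (factors labelled from right to left). -/
def wordW {A B D : Type*} [Fintype A] [Fintype B] [Fintype D] [DecidableEq A] [DecidableEq B]
    (X : A × B × B × D → ℂ) {p : ℕ} (f : Fin p → Letter) : Matrix (A × B) (A × B) ℂ :=
  (List.ofFn fun i => W X (f i)).reverse.prod

/-! ## Non-crossing partitions and alternations -/

/-- There are no `i < j < k < l` with `i, k` in one block and `j, l` in another block. -/
def IsNoncrossing {n : ℕ} (π : Finpartition (Finset.univ : Finset (Fin n))) : Prop :=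
  ∀ V ∈ π.parts, ∀ V' ∈ π.parts, ∀ i j k l : Fin n, i < j → j < k → k < l →
    i ∈ V → k ∈ V → j ∈ V' → l ∈ V' → V = V'

open Classical in
/-- The set `NC(n)` of non-crossing partitions of `n` linearly ordered points. -/
def NC (n : ℕ) : Finset (Finpartition (Finset.univ : Finset (Fin n))) :=
  Finset.univ.filter IsNoncrossing

/-- The permutation attached to a partition, whose cycles are the blocks in their cyclic order:
`a` is sent to the next element of its block, the last element of a block being sent to the
first one. -/
def blockSucc {n : ℕ} (π : Finpartition (Finset.univ : Finset (Fin n))) (a : Fin n) : Fin n :=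
  if h : ((π.part a).filter (a < ·)).Nonempty then ((π.part a).filter (a < ·)).min' h
  else (π.part a).min' ⟨a, by simp⟩

/-- `alt(f) = #{a : f(a) ≠ f(a + 1)}`, indices being cyclic. -/
def alt {p : ℕ} (f : Fin p → Letter) : ℕ :=
  (Finset.univ.filter fun a => f a ≠ f (finRotate p a)).card

/-- `alt(f, α) = #{a : f(a) ≠ f(α(a))}`, the partition `α` being seen as a permutation. -/
def altNC {p : ℕ} (f : Fin p → Letter)
    (α : Finpartition (Finset.univ : Finset (Fin p))) : ℕ :=
  (Finset.univ.filter fun a => f a ≠ f (blockSucc α a)).card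

/-! ## Free cumulants and convergence in distribution -/

section FreeProbability

variable {𝒜 : Type*} [Ring 𝒜] [Algebra ℂ 𝒜]

/-- The free cumulants `κ_n(a_1, …, a_n)` of a linear functional `φ`, defined by recursion through
the moment-cumulant formula: the term of the one-block partition in
`φ(a_1 ⋯ a_n) = ∑_{π ∈ NC(n)} ∏_{V ∈ π} κ_{|V|}(a_i : i ∈ V)` is solved for
(see `moment_cumulant`). -/
def freeCumulant (φ : 𝒜 →ₗ[ℂ] ℂ) (n : ℕ) (a : Fin n → 𝒜) : ℂ :=
  φ (List.ofFn a).prod -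
    ∑ π : {π // π ∈ (NC n).filter fun π => Finset.univ ∉ π.parts},
      ∏ V : {V // V ∈ π.1.parts}, freeCumulant φ V.1.card fun i => a (V.1.orderEmbOfFin rfl i)
termination_by n
decreasing_by
  have hπ := (Finset.mem_filter.mp π.2).2
  have hV : V.1 ≠ Finset.univ := ne_of_mem_of_not_mem V.2 hπ
  simpa using Finset.card_lt_card (Finset.ssubset_univ_iff.mpr hV)

/-- The moment-cumulant formula. -/
theorem moment_cumulant (φ : 𝒜 →ₗ[ℂ] ℂ) {n : ℕ} (hn : 0 < n) (a : Fin n → 𝒜) :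
    φ (List.ofFn a).prod = ∑ π ∈ NC n, ∏ V : {V // V ∈ π.parts},
      freeCumulant φ V.1.card fun i => a (V.1.orderEmbOfFin rfl i) := by
  classical
  have : Nonempty (Fin n) := ⟨⟨0, hn⟩⟩
  have hne : (Finset.univ : Finset (Fin n)) ≠ ⊥ := Finset.univ_nonempty.ne_empty
  have key : ∀ (s : Finset (Fin n)) (k : ℕ) (h : s.card = k),
      (freeCumulant φ s.card fun i => a (s.orderEmbOfFin rfl i)) =
        freeCumulant φ k fun i => a (s.orderEmbOfFin h i) := by
    rintro s _ rfl; rfl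
  have hid : ∀ i : Fin n,
      (Finset.univ : Finset (Fin n)).orderEmbOfFin (Finset.card_fin n) i = i := fun i =>
    (congrFun (Finset.orderEmbOfFin_unique (Finset.card_fin n) (f := id)
      (fun _ => Finset.mem_univ _) strictMono_id) i).symm
  have htop : (NC n).filter (fun π => ¬ Finset.univ ∉ π.parts) =
      {Finpartition.indiscrete hne} := by
    ext π
    simp only [Finset.mem_filter, Finset.mem_singleton, not_not]
    constructor
    · rintro ⟨-, h⟩
      have hsub : π.parts = {Finset.univ} := by
        refine Finset.eq_singleton_iff_unique_mem.mpr ⟨h, fun V hV => ?_⟩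
        obtain ⟨v, hv⟩ := π.nonempty_of_mem_parts hV
        exact π.eq_of_mem_parts hV h hv (Finset.mem_univ v)
      exact Finpartition.ext hsub
    · rintro rfl
      refine ⟨Finset.mem_filter.mpr ⟨Finset.mem_univ _, ?_⟩, by simp [Finpartition.indiscrete]⟩
      intro V hV V' hV'
      simp only [Finpartition.indiscrete, Finset.mem_singleton] at hV hV'
      simp [hV, hV']
  have hone : (∏ V : {V // V ∈ (Finpartition.indiscrete hne).parts},
      freeCumulant φ V.1.card fun i => a (V.1.orderEmbOfFin rfl i)) = freeCumulant φ n a := by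
    rw [Finset.prod_coe_sort (Finpartition.indiscrete hne).parts
      (fun V => freeCumulant φ V.card fun i => a (V.orderEmbOfFin rfl i))]
    simp only [Finpartition.indiscrete, Finset.prod_singleton]
    rw [key _ n (Finset.card_fin n)]
    simp only [hid]
  rw [← Finset.sum_filter_add_sum_filter_not (NC n) (fun π => Finset.univ ∉ π.parts), htop,
    Finset.sum_singleton, hone, freeCumulant,
    Finset.sum_coe_sort ((NC n).filter fun π => Finset.univ ∉ π.parts) (fun π =>
      ∏ V : {V // V ∈ π.parts}, freeCumulant φ V.1.card fun i => a (V.1.orderEmbOfFin rfl i))]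
  ring

/-- The pairs of random matrices `(Y N AB, Y N AC)`, seen as non-commutative random variables for
the functional `𝔼 (dim)⁻¹ Tr`, converge in distribution (that is, in moments), as `N → ∞`, to the
pair `(x AB, x AC)` of the non-commutative probability space `(𝒜, φ)`. -/
def ConvergesInDistribution {ι Ω : ℕ → Type*} [∀ N, Fintype (ι N)] [∀ N, DecidableEq (ι N)]
    [∀ N, MeasurableSpace (Ω N)] (μ : ∀ N, Measure (Ω N))
    (Y : ∀ N, Letter → Ω N → Matrix (ι N) (ι N) ℂ) (φ : 𝒜 →ₗ[ℂ] ℂ) (x : Letter → 𝒜) : Prop :=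
  ∀ (p : ℕ) (f : Fin p → Letter),
    (∀ N, Integrable (fun ω => (List.ofFn fun i => Y N (f i) ω).prod.trace) (μ N)) ∧
    Tendsto (fun N => ∫ ω, (Fintype.card (ι N) : ℂ)⁻¹ *
        (List.ofFn fun i => Y N (f i) ω).prod.trace ∂(μ N)) atTop
      (𝓝 (φ (List.ofFn fun i => x (f i)).prod))

end FreeProbability

end WishartTensor

end

/-! Expand the trace of a word of length `p` over indices and apply the Wick formula: the moment
becomes a sum over permutations `σ` of the `p` factors, each weighted by the number of index tuples
compatible with the pairing. Let `γ` be the cyclic shift. The `A`-indices are constant on the cycles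
of `σ γ⁻¹` and the `D`-indices on those of `σ`. The `B`- and `C`-indices form strands, joined
straight at `i` when `f i = f (σ i)` and crosswise otherwise; their number of colourings does not
depend on `N`.

As `D_N ~ cN`, the term of `σ` has order `N ^ (#σ + #(σ γ⁻¹))`. The exponent is at most `p + 1`,
with equality exactly for non-crossing `σ`; for these each crosswise joint costs exactly one free
colour, which leaves `m ^ (p + 1 - alt)` colourings. Division by `(mN) ^ (p + 1)` gives `c ^ #σ * m
^ (-alt)`.

`genus_induction` proves both facts by removing a point `b` that is either fixed by `σ` or satisfies
`b = σ a = γ a`. Without crosswise joints, two colours give `2 ^ (#σ + #(σ γ⁻¹))` colourings, so one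
recursion for colourings also counts cycles. If no such point exists, `σ` and `σ γ⁻¹` have no fixed
points, hence too few cycles.

Finally `#α` and `alt (f, α)` are additive over blocks, so the limit moments already have the shape
of the moment-cumulant formula, which determines the cumulants (`freeCumulant_eq_of_moments`). -/

namespace WishartTensor

/-! ### Cyclic arcs and non-crossing permutations -/

section Arcs

variable {T : Type*} [LinearOrder T]

/-- `j` lies strictly between `x` and `y` in the cyclic order; the arc from `x` to `x` is the
complement of `x`. -/
def Arc (x y j : T) : Prop := (x < y ∧ x < j ∧ j < y) ∨ (y ≤ x ∧ (x < j ∨ j < y))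

/-- `γ` sends every point to the next one in the cyclic order. -/
def IsCyclicSucc (γ : Equiv.Perm T) : Prop := ∀ i j, ¬ Arc i (γ i) j

/-- The cycles of `α` do not cross, and `α` runs through each of them in the cyclic order. -/
def IsNoncrossingPerm (α : Equiv.Perm T) : Prop := ∀ i j, Arc i (α i) j → Arc i (α i) (α j)

end Arcs

/-! ### Strand colourings and the removal of a point -/

section Skip

variable {T : Type*}

open Classical in
/-- The permutation induced on the complement of `b` by skipping `b`. -/
noncomputable def skip (σ : Equiv.Perm T) (b : T) : Equiv.Perm {x // x ≠ b} :=
  (Equiv.swap b (σ b) * σ).subtypePerm fun x => by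
    simp only [Equiv.Perm.mul_apply, ne_eq]
    rw [Equiv.swap_apply_eq_iff, Equiv.swap_apply_left, σ.injective.eq_iff]

open Classical in
theorem skip_apply (σ : Equiv.Perm T) (b : T) (x : {x // x ≠ b}) :
    (skip σ b x : T) = if σ x = b then σ b else σ x := by
  have hx : σ x ≠ σ b := fun h => x.2 (σ.injective h)
  simp only [skip, Equiv.Perm.subtypePerm_apply, Equiv.Perm.mul_apply, Equiv.swap_apply_def, hx,
    if_false]

/-- The pairs of colourings `(u, t)` of the strands: at `i` the strands `u (γ i)`, `t i` are
joined to `u (α i)`, `t (α i)`, in this order if `i ∉ S` and crosswise if `i ∈ S`. -/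
def strandColorings (γ α : Equiv.Perm T) (S : T → Prop) (X : Type*) : Set ((T → X) × (T → X)) :=
  {h | ∀ i, (S i → h.1 (γ i) = h.2 (α i) ∧ h.2 i = h.1 (α i)) ∧
    (¬ S i → h.1 (γ i) = h.1 (α i) ∧ h.2 i = h.2 (α i))}

/-- Restriction of a pair of functions to the complement of `b`. -/
def restrictPair {X : Type*} (b : T) (h : (T → X) × (T → X)) :
    ({x // x ≠ b} → X) × ({x // x ≠ b} → X) := (fun i => h.1 i, fun i => h.2 i)

open Classical in
/-- Extension of a pair of functions from the complement of `b` by the values `x`, `y`. -/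
noncomputable def extendPair {X : Type*} {b : T} (h : ({x // x ≠ b} → X) × ({x // x ≠ b} → X))
    (x y : X) : (T → X) × (T → X) :=
  (fun i => if hi : i = b then x else h.1 ⟨i, hi⟩, fun i => if hi : i = b then y else h.2 ⟨i, hi⟩)

theorem restrictPair_extendPair {X : Type*} {b : T}
    (h : ({x // x ≠ b} → X) × ({x // x ≠ b} → X)) (x y : X) :
    restrictPair b (extendPair h x y) = h := by
  ext i <;> simp [restrictPair, extendPair, i.2]

theorem extendPair_restrictPair {X : Type*} {b : T} (h : (T → X) × (T → X)) :
    extendPair (restrictPair b h) (h.1 b) (h.2 b) = h := by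
  ext i <;> simp only [restrictPair, extendPair] <;> split_ifs with hi <;> simp [hi]

variable {γ α : Equiv.Perm T} {a : T}

/-- The strand `t a` is joined only to itself, a closed loop with a free colour. The strand `u a`
merely continues `u (γ a)`, so it can be contracted. -/
theorem card_strandColorings_of_fixed (hγ : γ a ≠ a) (hα : α a = a) (S : T → Prop) (X : Type*)
    (hS : ¬ S a) :
    Nat.card (strandColorings γ α S X) =
      Nat.card (strandColorings (skip γ a) (skip α a) (fun i => S i) X) * Nat.card X := by
  rw [← Nat.card_prod]
  refine Nat.card_congr
    { toFun := fun h => (⟨restrictPair a h, ?_⟩, h.1.2 a)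
      invFun := fun h => ⟨extendPair h.1.1 (h.1.1.1 ⟨γ a, hγ⟩) h.2, ?_⟩
      left_inv := ?_
      right_inv := ?_ }
  · intro i
    have h1 := h.2 i
    have h2 := h.2 a
    have h3 := skip_apply γ a i
    have h4 := skip_apply α a i
    have h5 : α i ≠ a := fun h => i.2 (α.injective (h.trans hα.symm))
    simp only [restrictPair, h3, h4, h5]
    grind
  · intro i
    obtain ⟨⟨h, hh⟩, x⟩ := h
    by_cases hi : i = a
    · subst hi
      simp [extendPair, hα, hγ, hS]
    · have h1 := hh ⟨i, hi⟩
      have h5 : α i ≠ a := fun h => hi (α.injective (h.trans hα.symm))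
      have h4 : skip α a ⟨i, hi⟩ = ⟨α i, h5⟩ := Subtype.ext (by rw [skip_apply]; simp [h5])
      by_cases h6 : γ i = a
      · have h3 : skip γ a ⟨i, hi⟩ = ⟨γ a, hγ⟩ := Subtype.ext (by rw [skip_apply]; simp [h6])
        rw [h3, h4] at h1
        simpa [extendPair, hi, h5, h6] using h1
      · have h3 : skip γ a ⟨i, hi⟩ = ⟨γ i, h6⟩ := Subtype.ext (by rw [skip_apply]; simp [h6])
        rw [h3, h4] at h1
        simpa [extendPair, hi, h5, h6] using h1
  · rintro ⟨h, hh⟩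
    apply Subtype.ext
    have h1 : h.1 (γ a) = h.1 a := by have := hh a; grind
    simp only [restrictPair, h1]
    exact extendPair_restrictPair h
  · rintro ⟨⟨h, hh⟩, x⟩
    simp [restrictPair_extendPair]
    simp [extendPair]

/-- The crosswise joint inserts `t a` between `u a` and `u (γ a)`: the loop of the straight case is
absorbed and its factor is lost. -/
theorem card_strandColorings_of_fixed_mem (hγ : γ a ≠ a) (hα : α a = a) (S : T → Prop) (X : Type*)
    (hS : S a) :
    Nat.card (strandColorings γ α S X) =
      Nat.card (strandColorings (skip γ a) (skip α a) (fun i => S i) X) := by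
  refine Nat.card_congr
    { toFun := fun h => ⟨restrictPair a h, ?_⟩
      invFun := fun h => ⟨extendPair h.1 (h.1.1 ⟨γ a, hγ⟩) (h.1.1 ⟨γ a, hγ⟩), ?_⟩
      left_inv := ?_
      right_inv := ?_ }
  · intro i
    have h1 := h.2 i
    have h2 := h.2 a
    have h3 := skip_apply γ a i
    have h4 := skip_apply α a i
    have h5 : α i ≠ a := fun h => i.2 (α.injective (h.trans hα.symm))
    simp only [restrictPair, h3, h4, h5]
    grind
  · intro i
    obtain ⟨h, hh⟩ := h
    by_cases hi : i = a
    · subst hi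
      simp [extendPair, hα, hγ, hS]
    · have h1 := hh ⟨i, hi⟩
      have h5 : α i ≠ a := fun h => hi (α.injective (h.trans hα.symm))
      have h4 : skip α a ⟨i, hi⟩ = ⟨α i, h5⟩ := Subtype.ext (by rw [skip_apply]; simp [h5])
      by_cases h6 : γ i = a
      · have h3 : skip γ a ⟨i, hi⟩ = ⟨γ a, hγ⟩ := Subtype.ext (by rw [skip_apply]; simp [h6])
        rw [h3, h4] at h1
        simpa [extendPair, hi, h5, h6] using h1
      · have h3 : skip γ a ⟨i, hi⟩ = ⟨γ i, h6⟩ := Subtype.ext (by rw [skip_apply]; simp [h6])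
        rw [h3, h4] at h1
        simpa [extendPair, hi, h5, h6] using h1
  · rintro ⟨h, hh⟩
    apply Subtype.ext
    have h1 : h.1 (γ a) = h.1 a := by have := hh a; grind
    have h2 : h.2 a = h.1 a := by have := hh a; grind
    have h3 := extendPair_restrictPair (b := a) h
    rw [h2] at h3
    simp only [restrictPair, h1]
    exact h3
  · rintro ⟨h, hh⟩
    simp [restrictPair_extendPair]

open Classical in
/-- The set induced on the complement of `b` when `a` takes over the membership of `b`. -/
def mergeInto (S : T → Prop) (a b : T) (i : {x // x ≠ b}) : Prop :=
  if (i : T) = a then S b else S i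

/-- Here `u b` is the free loop, and `t a = t b` lets `a` play the part of `b`; this is why `a`
inherits the membership of `b` in `S`. -/
theorem card_strandColorings_of_succ {b : T} (hab : b ≠ a) (hγ : γ a = b) (hα : α a = b)
    (S : T → Prop) (X : Type*) (hS : ¬ S a) :
    Nat.card (strandColorings γ α S X) =
      Nat.card (strandColorings (skip γ b) (skip α b) (mergeInto S a b) X) *
        Nat.card X := by
  rw [← Nat.card_prod]
  refine Nat.card_congr
    { toFun := fun h => (⟨restrictPair b h, ?_⟩, h.1.1 b)
      invFun := fun h => ⟨extendPair h.1.1 h.2 (h.1.1.2 ⟨a, hab.symm⟩), ?_⟩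
      left_inv := ?_
      right_inv := ?_ }
  · intro i
    have h1 := h.2 i
    have h2 := h.2 a
    have h2' := h.2 b
    have h3 := skip_apply γ b i
    have h4 := skip_apply α b i
    have h5 : α i = b → (i : T) = a := fun h => (α.injective (h.trans hα.symm))
    have h6 : γ i = b → (i : T) = a := fun h => (γ.injective (h.trans hγ.symm))
    simp only [restrictPair, h3, h4, mergeInto]
    grind
  · intro i
    obtain ⟨⟨h, hh⟩, x⟩ := h
    have hγb : γ b ≠ b := fun h => hab (γ.injective (h.trans hγ.symm))
    have hαb : α b ≠ b := fun h => hab (α.injective (h.trans hα.symm))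
    by_cases hi : i = a
    · subst hi
      simp [extendPair, hα, hγ, hS, hab.symm]
    by_cases hib : i = b
    · subst hib
      have h1 := hh ⟨a, hab.symm⟩
      have h4 : skip α i ⟨a, hab.symm⟩ = ⟨α i, hαb⟩ :=
        Subtype.ext (by rw [skip_apply]; simp [hα])
      have h3 : skip γ i ⟨a, hab.symm⟩ = ⟨γ i, hγb⟩ :=
        Subtype.ext (by rw [skip_apply]; simp [hγ])
      rw [h3, h4] at h1
      simpa [mergeInto, extendPair, hγb, hαb] using h1
    have h1 := hh ⟨i, hib⟩
    have h5 : α i ≠ b := fun h => hi (α.injective (h.trans hα.symm))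
    have h6 : γ i ≠ b := fun h => hi (γ.injective (h.trans hγ.symm))
    have h4 : skip α b ⟨i, hib⟩ = ⟨α i, h5⟩ := Subtype.ext (by rw [skip_apply]; simp [h5])
    have h3 : skip γ b ⟨i, hib⟩ = ⟨γ i, h6⟩ := Subtype.ext (by rw [skip_apply]; simp [h6])
    rw [h3, h4] at h1
    simpa [mergeInto, extendPair, hi, hib, h5, h6] using h1
  · rintro ⟨h, hh⟩
    apply Subtype.ext
    have h1 : h.2 a = h.2 b := by have := hh a; grind
    simp only [restrictPair, h1]
    exact extendPair_restrictPair h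
  · rintro ⟨⟨h, hh⟩, x⟩
    simp [restrictPair_extendPair]
    simp [extendPair]

/-- The crosswise joint at `a` forces `t a = u b = t b`, so the loop `u b` is no longer free. -/
theorem card_strandColorings_of_succ_mem {b : T} (hab : b ≠ a) (hγ : γ a = b) (hα : α a = b)
    (S : T → Prop) (X : Type*) (hS : S a) :
    Nat.card (strandColorings γ α S X) =
      Nat.card
        (strandColorings (skip γ b) (skip α b) (mergeInto S a b) X) := by
  refine Nat.card_congr
    { toFun := fun h => ⟨restrictPair b h, ?_⟩
      invFun := fun h => ⟨extendPair h.1 (h.1.2 ⟨a, hab.symm⟩) (h.1.2 ⟨a, hab.symm⟩), ?_⟩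
      left_inv := ?_
      right_inv := ?_ }
  · intro i
    have h1 := h.2 i
    have h2 := h.2 a
    have h2' := h.2 b
    have h3 := skip_apply γ b i
    have h4 := skip_apply α b i
    have h5 : α i = b → (i : T) = a := fun h => (α.injective (h.trans hα.symm))
    have h6 : γ i = b → (i : T) = a := fun h => (γ.injective (h.trans hγ.symm))
    simp only [restrictPair, h3, h4, mergeInto]
    grind
  · intro i
    obtain ⟨h, hh⟩ := h
    have hγb : γ b ≠ b := fun h => hab (γ.injective (h.trans hγ.symm))
    have hαb : α b ≠ b := fun h => hab (α.injective (h.trans hα.symm))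
    by_cases hi : i = a
    · subst hi
      simp [extendPair, hα, hγ, hS, hab.symm]
    by_cases hib : i = b
    · subst hib
      have h1 := hh ⟨a, hab.symm⟩
      have h4 : skip α i ⟨a, hab.symm⟩ = ⟨α i, hαb⟩ :=
        Subtype.ext (by rw [skip_apply]; simp [hα])
      have h3 : skip γ i ⟨a, hab.symm⟩ = ⟨γ i, hγb⟩ :=
        Subtype.ext (by rw [skip_apply]; simp [hγ])
      rw [h3, h4] at h1
      simpa [mergeInto, extendPair, hγb, hαb] using h1
    have h1 := hh ⟨i, hib⟩
    have h5 : α i ≠ b := fun h => hi (α.injective (h.trans hα.symm))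
    have h6 : γ i ≠ b := fun h => hi (γ.injective (h.trans hγ.symm))
    have h4 : skip α b ⟨i, hib⟩ = ⟨α i, h5⟩ := Subtype.ext (by rw [skip_apply]; simp [h5])
    have h3 : skip γ b ⟨i, hib⟩ = ⟨γ i, h6⟩ := Subtype.ext (by rw [skip_apply]; simp [h6])
    rw [h3, h4] at h1
    simpa [mergeInto, extendPair, hi, hib, h5, h6] using h1
  · rintro ⟨h, hh⟩
    apply Subtype.ext
    have h1 : h.2 a = h.2 b := by have := hh a; have := hh b; grind
    have h2 : h.1 b = h.2 b := by have := hh a; grind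
    have h3 := extendPair_restrictPair (b := b) h
    rw [h2] at h3
    simp only [restrictPair, h1]
    exact h3
  · rintro ⟨h, hh⟩
    simp [restrictPair_extendPair]

end Skip

/-! ### Non-crossing permutations under removal of a point -/

section Order

variable {T : Type*} [LinearOrder T] {γ α : Equiv.Perm T} {a : T}

theorem IsCyclicSucc.skip (h : IsCyclicSucc γ) (b : T) : IsCyclicSucc (skip γ b) := by
  intro i j
  have h1 := h i j
  have h2 := h b j
  have h3 := h i b
  have hi := i.2
  have hj := j.2
  have h4 := skip_apply γ b i
  have e : Arc i (WishartTensor.skip γ b i) j ↔ Arc (i : T) (WishartTensor.skip γ b i : T) j :=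
    Iff.rfl
  rw [e, h4]
  split_ifs with hb
  · simp only [hb, Arc] at *
    grind
  · exact h1

theorem IsCyclicSucc.apply_ne (h : IsCyclicSucc γ) [Nontrivial T] (a : T) : γ a ≠ a := by
  intro ha
  obtain ⟨j, hj⟩ := exists_ne a
  have := h a j
  simp only [Arc, ha] at this
  grind

theorem isNoncrossingPerm_skip_iff_of_fixed (hα : α a = a) :
    IsNoncrossingPerm (skip α a) ↔ IsNoncrossingPerm α := by
  have key : ∀ i : {x // x ≠ a}, (skip α a i : T) = α i := fun i => by
    rw [skip_apply, if_neg]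
    exact fun h => i.2 (α.injective (h.trans hα.symm))
  have e : ∀ i j : {x // x ≠ a}, (Arc i (skip α a i) j ↔ Arc (i : T) (α i : T) j) ∧
      (Arc i (skip α a i) (skip α a j) ↔ Arc (i : T) (α i : T) (α j)) := fun i j => by
    rw [← key, ← key]; exact ⟨Iff.rfl, Iff.rfl⟩
  constructor
  · intro h i j hij
    by_cases hi : i = a
    · subst hi
      rw [hα] at hij ⊢
      have : j ≠ i := by rintro rfl; simp [Arc] at hij
      have : α j ≠ i := fun h => this (α.injective (h.trans hα.symm))
      simp only [Arc] at *
      grind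
    by_cases hj : j = a
    · subst hj; rwa [hα]
    · exact (e ⟨i, hi⟩ ⟨j, hj⟩).2.1 (h _ _ ((e ⟨i, hi⟩ ⟨j, hj⟩).1.2 hij))
  · intro h i j hij
    exact (e i j).2.2 (h _ _ ((e i j).1.1 hij))

/-- No point lies strictly between `a` and `b`. The arc from `a` to `b` is therefore empty, and the
arc from `a` to `α b` differs from the arc from `b` to `α b` only by the point `b`. -/
theorem isNoncrossingPerm_skip_iff_of_succ {b : T} (hγ : IsCyclicSucc γ) (hab : b ≠ a)
    (hγa : γ a = b) (hα : α a = b) :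
    IsNoncrossingPerm (skip α b) ↔ IsNoncrossingPerm α := by
  have key : ∀ i : {x // x ≠ b}, (skip α b i : T) = if (i : T) = a then α b else α i := fun i => by
    rw [skip_apply]
    have : α i = b ↔ (i : T) = a :=
      ⟨fun h => α.injective (h.trans hα.symm), fun h => h ▸ hα⟩
    simp only [this]
  have e : ∀ i j : {x // x ≠ b}, (Arc i (skip α b i) j ↔
      Arc (i : T) (if (i : T) = a then α b else α i : T) j) ∧
      (Arc i (skip α b i) (skip α b j) ↔ Arc (i : T) (if (i : T) = a then α b else α i : T)
        (if (j : T) = a then α b else α j : T)) := fun i j => by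
    rw [← key, ← key]; exact ⟨Iff.rfl, Iff.rfl⟩
  have hαb : α b ≠ b := fun h => hab (α.injective (h.trans hα.symm))
  have hi' : ∀ i, i ≠ a → α i ≠ b := fun i hi h => hi (α.injective (h.trans hα.symm))
  have hE : ∀ j, ¬ Arc a b j := fun j => hγa ▸ hγ a j
  constructor
  · intro h i j hij
    have hEj := hE (α j)
    have hE1 := hE j
    by_cases hia : i = a
    · subst hia
      rw [hα] at hij
      exact absurd hij (hE j)
    by_cases hib : i = b
    · subst hib
      by_cases hj : j = a
      · subst hj
        have h2 := hE (α i)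
        rw [hα]
        simp only [Arc] at *
        grind
      have hji : j ≠ i := by rintro rfl; simp only [Arc] at hij; grind
      have h1 := h ⟨a, hab.symm⟩ ⟨j, hji⟩
      rw [(e _ _).1, (e _ _).2] at h1
      simp only [if_true, hj, if_false] at h1
      have h3 := hi' j hj
      have h4 := hE (α i)
      simp only [Arc] at *
      grind
    by_cases hja : j = a
    · subst hja
      have h4 := hE (α i)
      have h3 := hi' i hia
      have h4 := hE i
      rw [hα]
      simp only [Arc] at *
      grind
    by_cases hjb : j = b
    · subst hjb
      have h1 := h ⟨i, hib⟩ ⟨a, hab.symm⟩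
      rw [(e _ _).1, (e _ _).2] at h1
      simp only [if_true, hia, if_false] at h1
      have h4 := hE (α i)
      have h3 := hi' i hia
      have h5 := hE i
      have h6 : α i ≠ α j := fun h => hib (α.injective h)
      simp only [Arc] at *
      grind
    · have h1 := h ⟨i, hib⟩ ⟨j, hjb⟩
      rw [(e _ _).1, (e _ _).2] at h1
      simpa only [hia, hja, if_false, hij, true_imp_iff] using h1
  · intro h i j
    rw [(e _ _).1, (e _ _).2]
    have hi := i.2
    have hj := j.2
    have h1 := h i j
    have h2 := h b j
    have h3 := h i a
    have h4 := h i b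
    have h5 := h b a
    have h6 := hE j
    have h7 := hE (α j)
    have h8 := hE (α b)
    have h9 := hE (α i)
    have h10 := hE i
    have h11 := hi' i
    have h12 := hi' j
    have h13 : α i = α j → i = j := fun h => Subtype.ext (α.injective h)
    have h14 : α j ≠ α b := fun h => hj (α.injective h)
    have h15 : α i ≠ α b := fun h => hi (α.injective h)
    by_cases hia : (i : T) = a <;> by_cases hja : (j : T) = a <;>
      simp only [hia, hja, if_true, if_false] at * <;> simp only [Arc] at * <;> grind

theorem IsNoncrossingPerm.exists_apply_eq [Finite T] [Nonempty T] (hγ : IsCyclicSucc γ)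
    (h : IsNoncrossingPerm α) : ∃ a, α a = a ∨ α a = γ a := by
  have := Fintype.ofFinite T
  classical
  obtain ⟨z, hz⟩ := Finite.exists_min (id : T → T)
  let P : Finset T := Finset.univ.filter fun i => i ≤ α i
  have hP : P.Nonempty := ⟨z, by simpa [P] using hz (α z)⟩
  -- Take an innermost arc. If it contained points, its least point `j` would satisfy `j ≤ α j` with
  -- `α j` still inside, so the arc of `j` would have strictly fewer points.
  obtain ⟨i, hi, hmin⟩ := P.exists_min_image
    (fun i => (Finset.univ.filter fun j => i < j ∧ j < α i).card) hP
  simp only [P, Finset.mem_filter, Finset.mem_univ, true_and] at hi hmin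
  refine ⟨i, ?_⟩
  by_contra! hne
  obtain ⟨h1, h2⟩ := hne
  have hlt : i < α i := lt_of_le_of_ne hi (Ne.symm h1)
  -- `γ i` lies strictly between
  have hg : i < γ i ∧ γ i < α i := by
    have h3 := hγ i (α i)
    simp only [Arc] at h3
    grind
  let R : Finset T := Finset.univ.filter fun j => i < j ∧ j < α i
  have hR : R.Nonempty := ⟨γ i, by simpa [R] using hg⟩
  obtain ⟨j, hj, hjmin⟩ := R.exists_min_image id hR
  simp only [R, Finset.mem_filter, Finset.mem_univ, true_and, id] at hj hjmin
  have harc : ∀ k, Arc i (α i) k ↔ i < k ∧ k < α i := fun k => by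
    simp only [Arc]; grind
  have haj := (harc _).1 (h i j ((harc j).2 hj))
  have hle := hjmin (α j) haj
  refine absurd (hmin j hle) (not_le.2 (Finset.card_lt_card ?_))
  refine Finset.ssubset_iff_of_subset (fun k hk => ?_) |>.2 ⟨j, by simpa using hj, by simp⟩
  simp only [Finset.mem_filter, Finset.mem_univ, true_and] at hk ⊢
  exact ⟨hj.1.trans hk.1, hk.2.trans haj.2⟩

end Order

/-! ### Counting cycles -/

section Cycles

variable {T : Type*}

/-- The number of cycles of a permutation, fixed points included. -/
noncomputable def numCycles (σ : Equiv.Perm T) : ℕ :=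
  Nat.card (Quotient (Equiv.Perm.SameCycle.setoid σ))

theorem apply_eq_of_sameCycle {X : Type*} {σ : Equiv.Perm T} {g : T → X}
    (hg : ∀ i, g (σ i) = g i) {x y : T} (h : σ.SameCycle x y) : g x = g y := by
  obtain ⟨n, rfl⟩ := h
  have key : ∀ (n : ℕ) x, g ((σ ^ n) x) = g x := fun n => by
    induction n with
    | zero => simp
    | succ n ih => intro x; rw [pow_succ', Equiv.Perm.mul_apply, hg, ih]
  obtain ⟨n, rfl | rfl⟩ := n.eq_nat_or_neg
  · simp [key]
  · rw [zpow_neg, zpow_natCast, ← key n ((σ ^ n)⁻¹ x)]; simp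

theorem card_invariant [Finite T] (X : Type*) [Finite X] (σ : Equiv.Perm T) :
    Nat.card {g : T → X // ∀ i, g (σ i) = g i} = Nat.card X ^ numCycles σ := by
  rw [numCycles, ← Nat.card_fun]
  refine Nat.card_congr
    { toFun := fun g => fun q => Quotient.lift g.1 (fun x y h => apply_eq_of_sameCycle g.2 h) q
      invFun := fun g => ⟨fun i => g ⟦i⟧, fun i => congrArg g (Quotient.sound ?_)⟩
      left_inv := fun g => rfl
      right_inv := fun g => ?_ }
  · exact (Equiv.Perm.sameCycle_apply_left.2 (Equiv.Perm.SameCycle.refl σ i) : σ.SameCycle _ _)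
  · ext q
    induction q using Quotient.inductionOn
    rfl

/-- Without crosswise joints the two systems of strands decouple: `u` is invariant under `α * γ⁻¹`
and `t` under `α`. Cycle counts can thus be read off from colourings. -/
theorem card_strandColorings_false [Finite T] (γ α : Equiv.Perm T) (X : Type*) [Finite X] :
    Nat.card (strandColorings γ α (fun _ => False) X) =
      Nat.card X ^ (numCycles α + numCycles (α * γ⁻¹)) := by
  rw [add_comm, pow_add, ← card_invariant, ← card_invariant, ← Nat.card_prod]
  refine Nat.card_congr ((Equiv.subtypeEquivRight fun h => ?_).trans
    (Equiv.subtypeProdEquivProd (p := fun g : T → X => ∀ i, g ((α * γ⁻¹) i) = g i)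
      (q := fun g : T → X => ∀ i, g (α i) = g i)))
  simp only [strandColorings, Set.mem_ofPred_eq, false_imp_iff, not_false_iff, true_imp_iff,
    true_and, forall_and, Equiv.Perm.mul_apply]
  constructor
  · rintro ⟨h1, h2⟩
    exact ⟨fun i => by rw [← h1]; simp, fun i => (h2 i).symm⟩
  · rintro ⟨h1, h2⟩
    exact ⟨fun i => by have := h1 (γ i); simpa using this.symm, fun i => (h2 i).symm⟩

/-- Without fixed points each cycle contains two distinct points, a representative and its image. -/
theorem exists_apply_eq_of_card_lt [Finite T] {σ : Equiv.Perm T}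
    (h : Nat.card T < 2 * numCycles σ) : ∃ a, σ a = a := by
  by_contra! hne
  refine absurd h (not_lt.2 ?_)
  rw [mul_comm, numCycles, show 2 = Nat.card Bool by simp, ← Nat.card_prod]
  have hs : ∀ q : Quotient (Equiv.Perm.SameCycle.setoid σ),
      (⟦σ q.out⟧ : Quotient (Equiv.Perm.SameCycle.setoid σ)) = q := fun q => by
    conv_rhs => rw [← q.out_eq]
    exact Quotient.sound
      (Equiv.Perm.sameCycle_apply_left.2 (Equiv.Perm.SameCycle.refl σ _) : σ.SameCycle _ _)
  refine Nat.card_le_card_of_injective (fun x => if x.2 then x.1.out else σ x.1.out) ?_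
  rintro ⟨q, b⟩ ⟨q', b'⟩ hqq
  have e : q = q' := by
    have h1 := congrArg (fun t => (⟦t⟧ : Quotient (Equiv.Perm.SameCycle.setoid σ))) hqq
    cases b <;> cases b' <;> simpa [hs] using h1
  subst e
  have := hne q.out
  cases b <;> cases b'
  · rfl
  · exact absurd hqq this
  · exact absurd hqq.symm this
  · rfl

theorem ncard_setOf_subtype_ne [Finite T] (S : T → Prop) (a : T) (ha : ¬ S a) :
    {i : {x // x ≠ a} | S i}.ncard = {i | S i}.ncard := by
  rw [← Set.ncard_image_of_injective _ Subtype.val_injective]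
  congr 1
  ext i
  simp only [Set.mem_image, Set.mem_ofPred_eq, Subtype.exists, exists_and_left, exists_prop,
    exists_eq_right_right, and_iff_left_iff_imp]
  rintro h rfl
  exact ha h

theorem ncard_setOf_subtype_ne_mem [Finite T] (S : T → Prop) (a : T) (ha : S a) :
    {i : {x // x ≠ a} | S i}.ncard + 1 = {i | S i}.ncard := by
  rw [← Set.ncard_image_of_injective _ Subtype.val_injective,
    ← Set.ncard_sdiff_singleton_add_one (s := {i | S i}) (a := a) ha]
  congr 2
  ext i
  simp [and_comm]

open Classical in
-- Merging forgets the membership of `a` and moves that of `b` to `a`; the swap of `a` and `b` moves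
-- it back, leaving `S` with `a` removed.
theorem ncard_mergeInto [Finite T] (S : T → Prop) {a b : T} (hab : b ≠ a) :
    {i | mergeInto S a b i}.ncard + (if S a then 1 else 0) =
      {i | S i}.ncard := by
  have h := ncard_setOf_subtype_ne (fun i => if i = a then S b else if i = b then False else S i) b
    (by simp [hab])
  have e : {i | mergeInto S a b i} =
      {i : {x // x ≠ b} | if (i : T) = a then S b else if (i : T) = b then False else S i} := by
    ext i
    simp [i.2, mergeInto]
  rw [e, h]
  have h1 : {i | if i = a then S b else if i = b then False else S i}.ncard =
      {i | if i = a then False else S i}.ncard := by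
    rw [← Set.ncard_image_of_injective _ (Equiv.swap a b).injective]
    congr 1
    ext i
    simp only [Equiv.image_eq_preimage_symm, Set.mem_preimage, Set.mem_ofPred_eq,
      Equiv.symm_swap, Equiv.swap_apply_def]
    split_ifs <;> simp_all
  rw [h1]
  split_ifs with hS
  · rw [← Set.ncard_sdiff_singleton_add_one (s := {i | S i}) (a := a) hS]
    congr 2
    ext i
    simp only [Set.mem_ofPred_eq, Set.mem_sdiff, Set.mem_singleton_iff]
    split_ifs <;> simp_all
  · refine congrArg Set.ncard (Set.ext fun i => ?_)
    simp only [Set.mem_ofPred_eq]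
    split_ifs with h
    · simpa [h] using hS
    · rfl

end Cycles

/-! ### The genus inequality and its planar case -/

section Genus

/-- The genus inequality for a pair of permutations, its case of equality, and the number of
strand colourings in this case. -/
theorem genus_induction (n : ℕ) : ∀ (T : Type) [Finite T] [LinearOrder T] (γ α : Equiv.Perm T),
    Nat.card T = n + 1 → IsCyclicSucc γ →
    numCycles α + numCycles (α * γ⁻¹) ≤ n + 2 ∧
    (numCycles α + numCycles (α * γ⁻¹) = n + 2 ↔ IsNoncrossingPerm α) ∧
    (IsNoncrossingPerm α → ∀ (S : T → Prop) (X : Type) [Finite X],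
      Nat.card (strandColorings γ α S X) * Nat.card X ^ {i | S i}.ncard =
        Nat.card X ^ (n + 2)) := by
  classical
  induction n with
  | zero =>
    intro T _ _ γ α hT hγ
    obtain ⟨hs, ⟨a⟩⟩ := Nat.card_eq_one_iff_unique.1 hT
    have hnum : ∀ σ : Equiv.Perm T, numCycles σ = 1 := fun σ =>
      Nat.card_eq_one_iff_unique.2 ⟨inferInstance, ⟨⟦a⟧⟩⟩
    have hQ : IsNoncrossingPerm α := fun i j hij => by
      rw [Subsingleton.elim (α j) j]; exact hij
    refine ⟨by simp [hnum], by simp [hnum, hQ], fun _ S X _ => ?_⟩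
    have hα := Subsingleton.elim α 1
    have hγ := Subsingleton.elim γ 1
    subst hα hγ
    by_cases hS : S a
    · have h1 : {i | S i}.ncard = 1 := by
        rw [Set.ncard_eq_one]
        exact ⟨a, by ext i; simpa [Subsingleton.elim i a] using hS⟩
      rw [h1, pow_one, pow_two]
      congr 1
      refine Nat.card_congr
        { toFun := fun h => h.1.1 a
          invFun := fun x => ⟨(fun _ => x, fun _ => x), fun i => by simp⟩
          left_inv := ?_
          right_inv := fun x => rfl }
      rintro ⟨⟨u, t⟩, h⟩
      have h2 := (h a).1 hS
      simp only [Equiv.Perm.one_apply] at h2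
      ext i <;> simp [Subsingleton.elim i a, h2.1]
    · have h1 : {i | S i} = ∅ := by
        ext i; simpa [Subsingleton.elim i a] using hS
      rw [h1, Set.ncard_empty, pow_zero, mul_one]
      have h2 : S = fun _ => False := by
        ext i; simpa [Subsingleton.elim i a] using hS
      rw [h2, card_strandColorings_false, hnum, hnum]
  | succ n ih =>
    intro T _ _ γ α hT hγ
    have hnt : Nontrivial T := Finite.one_lt_card_iff_nontrivial.1 (by omega)
    have hT' : ∀ b : T, Nat.card {x // x ≠ b} = n + 1 := fun b => by
      have := Fintype.ofFinite T
      rw [Nat.card_eq_fintype_card] at hT ⊢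
      simp [hT]
    have hb : Nat.card Bool = 2 := by simp
    -- the reduced permutations
    have red : ∀ a, (α a = a ∨ α a = γ a) → ∃ b : T,
        numCycles α + numCycles (α * γ⁻¹) =
          numCycles (skip α b) + numCycles (skip α b * (skip γ b)⁻¹) + 1 ∧
        (IsNoncrossingPerm (skip α b) ↔ IsNoncrossingPerm α) ∧
        ∀ (S : T → Prop), ∃ S' : {x // x ≠ b} → Prop, ∀ (X : Type) [Finite X],
          Nat.card (strandColorings γ α S X) * Nat.card X ^ {i | S i}.ncard =
            Nat.card (strandColorings (skip γ b) (skip α b) S' X) *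
              Nat.card X ^ {i | S' i}.ncard * Nat.card X := by
      intro a ha
      by_cases hfix : α a = a
      · refine ⟨a, ?_, isNoncrossingPerm_skip_iff_of_fixed hfix, fun S => ⟨fun i => S i, ?_⟩⟩
        -- With two colours and no crosswise joint, both colouring counts are powers of `2`;
        -- comparing exponents gives the recursion for cycles.
        · have h := card_strandColorings_of_fixed (hγ.apply_ne a) hfix (fun _ => False) Bool
            not_false
          rw [card_strandColorings_false, card_strandColorings_false, ← pow_succ] at h
          exact Nat.pow_right_injective (le_of_eq hb.symm) h
        · intro X _
          by_cases hS : S a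
          · rw [card_strandColorings_of_fixed_mem (hγ.apply_ne a) hfix S X hS,
              ← ncard_setOf_subtype_ne_mem S a hS, pow_succ, mul_assoc]
          · rw [card_strandColorings_of_fixed (hγ.apply_ne a) hfix S X hS,
              ncard_setOf_subtype_ne S a hS]
            ring
      · have hα : α a = γ a := ha.resolve_left hfix
        have hab := hγ.apply_ne a
        refine ⟨γ a, ?_, isNoncrossingPerm_skip_iff_of_succ hγ hab rfl hα,
          fun S => ⟨mergeInto S a (γ a), ?_⟩⟩
        · have h := card_strandColorings_of_succ hab rfl hα (fun _ => False) Bool not_false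
          rw [show mergeInto (fun _ : T => False) a (γ a) = fun _ => False by
            ext i; simp [mergeInto]] at h
          rw [card_strandColorings_false, card_strandColorings_false, ← pow_succ] at h
          exact Nat.pow_right_injective (le_of_eq hb.symm) h
        · intro X _
          rw [← ncard_mergeInto S hab]
          by_cases hS : S a
          · rw [card_strandColorings_of_succ_mem hab rfl hα S X hS, if_pos hS, pow_succ,
              mul_assoc]
          · rw [card_strandColorings_of_succ hab rfl hα S X hS, if_neg hS, add_zero]
            ring
    by_cases hex : ∃ a, α a = a ∨ α a = γ a
    · obtain ⟨a, ha⟩ := hex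
      obtain ⟨b, h1, h2, h3⟩ := red a ha
      obtain ⟨i1, i2, i3⟩ := ih {x // x ≠ b} (skip γ b) (skip α b) (hT' b) (hγ.skip b)
      refine ⟨by omega, by rw [← h2, ← i2]; omega, fun hα S X _ => ?_⟩
      obtain ⟨S', hS'⟩ := h3 S
      rw [hS', i3 (h2.2 hα), ← pow_succ]
    -- A fixed point of `α * γ⁻¹` is `γ a` for some `a` with `α a = γ a`. In the irreducible case
    -- neither permutation has fixed points, so each has at most `(n + 2) / 2` cycles.
    · have hlt : numCycles α + numCycles (α * γ⁻¹) < n + 1 + 2 := by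
        by_contra hle
        have h1 : ¬ Nat.card T < 2 * numCycles α := fun h => by
          obtain ⟨a, ha⟩ := exists_apply_eq_of_card_lt h
          exact hex ⟨a, Or.inl ha⟩
        have h2 : ¬ Nat.card T < 2 * numCycles (α * γ⁻¹) := fun h => by
          obtain ⟨a, ha⟩ := exists_apply_eq_of_card_lt h
          exact hex ⟨γ⁻¹ a, Or.inr (by simpa using ha)⟩
        omega
      have hQ : ¬ IsNoncrossingPerm α := fun h => hex (h.exists_apply_eq hγ)
      exact ⟨hlt.le, ⟨fun h => absurd h hlt.ne, fun h => absurd h hQ⟩, fun h => absurd h hQ⟩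

end Genus

/-! ### Arcs along a cycle -/

section OrbitArcs

variable {T : Type*} [LinearOrder T] [Finite T] {σ : Equiv.Perm T}

/-- Start the arc at the largest point of the cycle below `b`; if there is none, at the largest
point of the cycle, whose arc wraps around. -/
theorem exists_arc_of_not_sameCycle {a b : T} (h : ¬ σ.SameCycle a b) :
    ∃ i, σ.SameCycle a i ∧ Arc i (σ i) b := by
  classical
  have := Fintype.ofFinite T
  have hne : ∀ i, σ.SameCycle a i → i ≠ b := by rintro i hi rfl; exact h hi
  by_cases hex : ∃ i, σ.SameCycle a i ∧ i < b
  · obtain ⟨i₀, hi₀⟩ := hex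
    obtain ⟨i, hi, hmax⟩ := (Finset.univ.filter fun i => σ.SameCycle a i ∧ i < b).exists_max_image
      id ⟨i₀, by simpa using hi₀⟩
    simp only [Finset.mem_filter, Finset.mem_univ, true_and, id] at hi hmax
    have h1 : σ.SameCycle a (σ i) := Equiv.Perm.sameCycle_apply_right.2 hi.1
    have h2 := hmax (σ i)
    have h3 := hne _ h1
    refine ⟨i, hi.1, ?_⟩
    simp only [Arc]
    grind
  · push Not at hex
    obtain ⟨i, hi, hmax⟩ := (Finset.univ.filter fun i => σ.SameCycle a i).exists_max_image
      id ⟨a, by simpa using Equiv.Perm.SameCycle.refl σ a⟩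
    simp only [Finset.mem_filter, Finset.mem_univ, true_and, id] at hi hmax
    have h1 : σ.SameCycle a (σ i) := Equiv.Perm.sameCycle_apply_right.2 hi
    have h2 := hmax (σ i) h1
    have h3 := hne _ h1
    have h4 := hex _ h1
    exact ⟨i, hi, Or.inr ⟨h2, Or.inr (lt_of_le_of_ne h4 h3.symm)⟩⟩

theorem IsNoncrossingPerm.arc_of_sameCycle (h : IsNoncrossingPerm σ) {x j l : T}
    (hj : Arc x (σ x) j) (hjl : σ.SameCycle j l) : Arc x (σ x) l := by
  obtain ⟨n, rfl⟩ := hjl.exists_nat_pow_eq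
  induction n with
  | zero => simpa using hj
  | succ n ih =>
    rw [pow_succ', Equiv.Perm.mul_apply]
    exact h _ _ (ih (Equiv.Perm.sameCycle_pow_right.2 (Equiv.Perm.SameCycle.refl σ j)))

/-- An arc containing a point of its own cycle would contain the whole cycle, hence its own starting
point. -/
theorem IsNoncrossingPerm.not_arc (h : IsNoncrossingPerm σ) {x j : T} (hj : σ.SameCycle x j) :
    ¬ Arc x (σ x) j := fun ha => by
  have := h.arc_of_sameCycle ha hj.symm
  simp only [Arc] at this
  grind

end OrbitArcs

/-! ### Non-crossing partitions as non-crossing permutations -/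

section BlockSucc

variable {n : ℕ} (π : Finpartition (Finset.univ : Finset (Fin n)))

theorem blockSucc_mem (a : Fin n) : blockSucc π a ∈ π.part a := by
  unfold blockSucc
  split_ifs with h
  · exact (Finset.mem_filter.1 (Finset.min'_mem _ h)).1
  · exact Finset.min'_mem _ _

theorem not_arc_blockSucc {a j : Fin n} (hj : j ∈ π.part a) : ¬ Arc a (blockSucc π a) j := by
  have ha : a ∈ π.part a := by simp
  unfold blockSucc
  split_ifs with h
  · have h1 := (Finset.mem_filter.1 (Finset.min'_mem _ h)).2
    have h2 : a < j → ((π.part a).filter (a < ·)).min' h ≤ j := fun h' =>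
      Finset.min'_le _ _ (Finset.mem_filter.2 ⟨hj, h'⟩)
    simp only [Arc]
    grind
  · have h1 : ¬ a < j := fun h' => h ⟨j, Finset.mem_filter.2 ⟨hj, h'⟩⟩
    have h2 := Finset.min'_le _ _ hj
    have h3 := Finset.min'_le _ _ ha
    simp only [Arc]
    grind

/-- The successor is characterised by an empty arc within the block, which replaces the case
distinction in `blockSucc`. -/
theorem blockSucc_eq_of_not_arc {a x : Fin n} (hx : x ∈ π.part a)
    (h : ∀ j ∈ π.part a, ¬ Arc a x j) : blockSucc π a = x := by
  have h1 := h _ (blockSucc_mem π a)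
  have h2 := not_arc_blockSucc π hx
  simp only [Arc] at h1 h2
  grind

theorem part_blockSucc (a : Fin n) : π.part (blockSucc π a) = π.part a :=
  (π.mem_part_iff_part_eq_part (Finset.mem_univ _) (Finset.mem_univ _)).1 (blockSucc_mem π a)

theorem blockSucc_injective : Function.Injective (blockSucc π) := by
  intro a b hab
  have hp : π.part a = π.part b := by rw [← part_blockSucc, hab, part_blockSucc]
  have h1 := not_arc_blockSucc π (a := a) (j := b) (by rw [hp]; simp)
  have h2 := not_arc_blockSucc π (a := b) (j := a) (by rw [← hp]; simp)
  rw [hab] at h1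
  simp only [Arc] at h1 h2
  grind

/-- The permutation whose cycles are the blocks of a partition. -/
noncomputable def blockPerm : Equiv.Perm (Fin n) :=
  Equiv.ofBijective (blockSucc π) (Finite.injective_iff_bijective.1 (blockSucc_injective π))

theorem blockPerm_apply (a : Fin n) : blockPerm π a = blockSucc π a := rfl

theorem sameCycle_blockPerm_iff {a b : Fin n} :
    (blockPerm π).SameCycle a b ↔ b ∈ π.part a := by
  rw [π.mem_part_iff_part_eq_part (Finset.mem_univ _) (Finset.mem_univ _), eq_comm]
  refine ⟨apply_eq_of_sameCycle (part_blockSucc π), fun h => ?_⟩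
  by_contra hab
  obtain ⟨i, hi, hib⟩ := exists_arc_of_not_sameCycle hab
  have h1 : π.part a = π.part i := apply_eq_of_sameCycle (part_blockSucc π) hi
  exact not_arc_blockSucc π (by rw [← h1, h]; simp) hib

variable {π}

theorem IsNoncrossing.isNoncrossingPerm (h : IsNoncrossing π) :
    IsNoncrossingPerm (blockPerm π) := by
  intro i j hij
  simp only [blockPerm_apply] at hij ⊢
  have hji : π.part j ≠ π.part i := fun hp => not_arc_blockSucc π (by rw [← hp]; simp) hij
  have hcr : ∀ i j k l : Fin n, i < j → j < k → k < l → π.part i = π.part k →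
      π.part j = π.part l → π.part i = π.part j := fun i j k l h1 h2 h3 h4 h5 =>
    h _ (by simp) _ (by simp) i j k l h1 h2 h3 (by simp) (by rw [h4]; simp) (by simp)
      (by rw [h5]; simp)
  have p1 := part_blockSucc π i
  have p2 := part_blockSucc π j
  generalize blockSucc π i = x at *
  generalize blockSucc π j = k at *
  have hki : k ≠ i := by rintro rfl; exact hji p2.symm
  have hkx : k ≠ x := by rintro rfl; exact hji (p2.symm.trans p1)
  by_contra hk
  -- The points `i, j, x, k` alternate between two blocks in the cyclic order. Any of them may come
  -- first in the linear order, hence the four rotations.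
  have h1 := hcr k i j x
  have h2 := hcr i j x k
  have h3 := hcr x k i j
  have h4 := hcr j x k i
  simp only [Arc] at hij hk
  grind

open Classical in
-- If `i, k` and `j, l` crossed, an arc of the cycle of `i` would contain `j`, hence also `l`, while
-- avoiding both `i` and `k`; no arc does this.
theorem isNoncrossing_ofSetoid {σ : Equiv.Perm (Fin n)} (h : IsNoncrossingPerm σ) :
    IsNoncrossing (Finpartition.ofSetoid (Equiv.Perm.SameCycle.setoid σ)) := by
  intro V hV V' hV' i j k l hij hjk hkl hi hk hj hl
  have hrel : ∀ a b, b ∈ (Finpartition.ofSetoid (Equiv.Perm.SameCycle.setoid σ)).part a ↔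
      σ.SameCycle a b := fun a b => Finpartition.mem_part_ofSetoid_iff_rel
  have e1 := Finpartition.part_eq_of_mem _ hV hi
  have e2 := Finpartition.part_eq_of_mem _ hV' hj
  have s1 : σ.SameCycle i k := by rwa [← hrel, e1]
  have s2 : σ.SameCycle j l := by rwa [← hrel, e2]
  by_contra hne
  have s3 : ¬ σ.SameCycle i j := fun hs => by
    rw [← hrel, e1] at hs
    exact hne (e1.symm.trans (by rw [← e2, Finpartition.part_eq_of_mem _ hV hs, e1]))
  obtain ⟨x, hx, hxj⟩ := exists_arc_of_not_sameCycle s3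
  have hxl := h.arc_of_sameCycle hxj s2
  have h1 := h.not_arc hx.symm
  have h2 := h.not_arc (hx.symm.trans s1)
  simp only [Arc] at h1 h2 hxj hxl
  grind

open Classical in
theorem blockPerm_ofSetoid {σ : Equiv.Perm (Fin n)} (h : IsNoncrossingPerm σ) :
    blockPerm (Finpartition.ofSetoid (Equiv.Perm.SameCycle.setoid σ)) = σ := by
  ext a
  rw [blockPerm_apply, blockSucc_eq_of_not_arc]
  · exact Finpartition.mem_part_ofSetoid_iff_rel.2
      (Equiv.Perm.sameCycle_apply_right.2 (Equiv.Perm.SameCycle.refl σ a))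
  · exact fun j hj => h.not_arc (Finpartition.mem_part_ofSetoid_iff_rel.1 hj)

theorem blockPerm_injective : Function.Injective
    (blockPerm : Finpartition (Finset.univ : Finset (Fin n)) → Equiv.Perm (Fin n)) := by
  have key : ∀ π π' : Finpartition (Finset.univ : Finset (Fin n)), blockPerm π = blockPerm π' →
      π.parts ⊆ π'.parts := by
    intro π π' h V hV
    obtain ⟨v, hv⟩ := π.nonempty_of_mem_parts hV
    have : V = π'.part v := by
      rw [← π.part_eq_of_mem hV hv]
      ext b
      rw [← sameCycle_blockPerm_iff, ← sameCycle_blockPerm_iff, h]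
    rw [this]
    simp
  exact fun π π' h => Finpartition.ext ((key _ _ h).antisymm (key _ _ h.symm))

theorem numCycles_blockPerm (π : Finpartition (Finset.univ : Finset (Fin n))) :
    numCycles (blockPerm π) = π.parts.card := by
  have hg : ∀ a b, (blockPerm π).SameCycle a b ↔ π.part a = π.part b := fun a b => by
    rw [sameCycle_blockPerm_iff,
      π.mem_part_iff_part_eq_part (Finset.mem_univ _) (Finset.mem_univ _), eq_comm]
  rw [numCycles, ← Nat.card_eq_finsetCard π.parts]
  refine Nat.card_congr (Equiv.ofBijective (fun q => Quotient.lift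
    (fun a => (⟨π.part a, by simp⟩ : π.parts)) (fun a b h => Subtype.ext ((hg a b).1 h)) q)
    ⟨fun q q' => ?_, fun V => ?_⟩)
  · induction q, q' using Quotient.inductionOn₂ with
    | _ a b => exact fun h => Quotient.sound ((hg a b).2 (congrArg Subtype.val h))
  · obtain ⟨v, hv⟩ := π.nonempty_of_mem_parts V.2
    exact ⟨⟦v⟧, Subtype.ext (π.part_eq_of_mem V.2 hv)⟩

theorem altNC_eq_ncard {f : Fin n → Letter} (π : Finpartition (Finset.univ : Finset (Fin n))) :
    altNC f π = {a | f a ≠ f (blockPerm π a)}.ncard := by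
  rw [altNC, ← Set.ncard_coe_finset]
  simp [blockPerm_apply]

open Classical in
theorem sum_NC_eq_sum_perm {M : Type*} [AddCommMonoid M] (F : Equiv.Perm (Fin n) → M) :
    ∑ π ∈ NC n, F (blockPerm π) = ∑ σ : Equiv.Perm (Fin n) with IsNoncrossingPerm σ, F σ := by
  refine Finset.sum_bij (fun π _ => blockPerm π) (fun π hπ => ?_)
    (fun _ _ _ _ h => blockPerm_injective h) (fun σ hσ => ?_) (fun _ _ => rfl)
  · simpa using ((Finset.mem_filter.1 hπ).2).isNoncrossingPerm
  · have h := (Finset.mem_filter.1 hσ).2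
    exact ⟨_, Finset.mem_filter.2 ⟨Finset.mem_univ _, isNoncrossing_ofSetoid h⟩,
      blockPerm_ofSetoid h⟩

end BlockSucc

/-! ### Additivity of alternations over blocks -/

section Blocks

theorem isCyclicSucc_finRotate (n : ℕ) : IsCyclicSucc (finRotate n) := by
  obtain _ | n := n
  · exact fun i => i.elim0
  intro i j
  have h := coe_finRotate i
  have hi := i.2
  have hj := j.2
  simp only [Arc, Fin.lt_def, Fin.le_def, h, Fin.ext_iff, Fin.val_last]
  split_ifs <;> omega

variable {n : ℕ} {π : Finpartition (Finset.univ : Finset (Fin n))} {V : Finset (Fin n)}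

theorem blockSucc_orderEmbOfFin (hV : V ∈ π.parts) (i : Fin V.card) :
    blockSucc π (V.orderEmbOfFin rfl i) = V.orderEmbOfFin rfl (finRotate _ i) := by
  have hp := π.part_eq_of_mem hV (V.orderEmbOfFin_mem rfl i)
  refine blockSucc_eq_of_not_arc π (by rw [hp]; exact V.orderEmbOfFin_mem rfl _) fun j hj => ?_
  rw [hp, ← Finset.mem_coe, ← V.range_orderEmbOfFin rfl] at hj
  obtain ⟨j, rfl⟩ := hj
  have := isCyclicSucc_finRotate _ i j
  simpa only [Arc, OrderEmbedding.lt_iff_lt, OrderEmbedding.le_iff_le] using this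

theorem altNC_eq_sum (f : Fin n → Letter) (π : Finpartition (Finset.univ : Finset (Fin n))) :
    altNC f π = ∑ V ∈ π.parts, alt fun i => f (V.orderEmbOfFin rfl i) := by
  have h1 : altNC f π = ∑ V ∈ π.parts, ∑ a ∈ V, if f a ≠ f (blockSucc π a) then 1 else 0 := by
    rw [altNC, Finset.card_filter]
    exact (Finset.sum_congr π.biUnion_parts.symm fun _ _ => rfl).trans
      (Finset.sum_biUnion π.disjoint)
  rw [h1]
  refine Finset.sum_congr rfl fun V hV => ?_
  rw [alt, Finset.card_filter]
  nth_rw 1 [← V.map_orderEmbOfFin_univ rfl]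
  rw [Finset.sum_map]
  refine Finset.sum_congr rfl fun i _ => ?_
  have := blockSucc_orderEmbOfFin hV i
  simp [this]

end Blocks

/-! ### Moments of the standard complex Gaussian law -/

section Moments

open scoped ComplexConjugate

theorem integrable_norm_pow_mul_exp (n : ℕ) :
    Integrable (fun z : ℂ => ‖z‖ ^ n * Real.exp (-‖z‖ ^ 2)) := by
  -- A non-integrable function has integral `0` by convention, whereas the closed formula gives a
  -- positive Gamma value.
  by_contra h
  have h1 := integral_undef h
  have h2 := Complex.integral_rpow_mul_exp_neg_rpow (p := 2) (q := n) (by norm_num)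
    (by have : (0 : ℝ) ≤ n := n.cast_nonneg
        linarith)
  simp only [Real.rpow_natCast, Real.rpow_ofNat] at h2
  rw [h1] at h2
  have : 0 < (2 * Real.pi / 2) * Real.Gamma (((n : ℝ) + 2) / 2) :=
    mul_pos (by positivity) (Real.Gamma_pos_of_pos (by positivity))
  exact this.ne h2

theorem integrable_stdComplexGaussian_iff {f : ℂ → ℂ} :
    Integrable f stdComplexGaussian ↔
      Integrable (fun z => (Real.pi⁻¹ * Real.exp (-‖z‖ ^ 2)) • f z) := by
  rw [stdComplexGaussian, integrable_withDensity_iff_integrable_smul' (by fun_prop) (by simp)]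
  refine integrable_congr (ae_of_all _ fun z => ?_)
  simp only
  rw [ENNReal.toReal_ofReal (by positivity)]

theorem integral_stdComplexGaussian (f : ℂ → ℂ) :
    ∫ z, f z ∂stdComplexGaussian = ∫ z, (Real.pi⁻¹ * Real.exp (-‖z‖ ^ 2)) • f z := by
  rw [stdComplexGaussian, integral_withDensity_eq_integral_toReal_smul (by fun_prop) (by simp)]
  refine integral_congr_ae (ae_of_all _ fun z => ?_)
  simp only
  rw [ENNReal.toReal_ofReal (by positivity)]

theorem integrable_pow_mul_conj_pow (a b : ℕ) :
    Integrable (fun z : ℂ => z ^ a * conj z ^ b) stdComplexGaussian := by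
  rw [integrable_stdComplexGaussian_iff]
  refine ((integrable_norm_pow_mul_exp (a + b)).const_mul Real.pi⁻¹).mono' ?_
    (ae_of_all _ fun z => le_of_eq ?_)
  · exact Continuous.aestronglyMeasurable (by fun_prop)
  · rw [norm_smul, Real.norm_of_nonneg (by positivity), norm_mul, norm_pow, norm_pow,
      RCLike.norm_conj, pow_add]
    ring

theorem integral_pow_mul_conj_pow (a b : ℕ) :
    ∫ z, z ^ a * conj z ^ b ∂stdComplexGaussian = if a = b then (a.factorial : ℂ) else 0 := by
  rw [integral_stdComplexGaussian]
  split_ifs with hab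
  · subst hab
    have h2 := Complex.integral_rpow_mul_exp_neg_rpow (p := 2) (q := (2 * a : ℕ)) (by norm_num)
      (by have : (0 : ℝ) ≤ (2 * a : ℕ) := Nat.cast_nonneg _
          linarith)
    simp only [Real.rpow_natCast, Real.rpow_ofNat] at h2
    have e : ∀ z : ℂ, (Real.pi⁻¹ * Real.exp (-‖z‖ ^ 2)) • (z ^ a * conj z ^ a) =
        ((Real.pi⁻¹ * (‖z‖ ^ (2 * a) * Real.exp (-‖z‖ ^ 2)) : ℝ) : ℂ) := fun z => by
      rw [← mul_pow, Complex.mul_conj, Complex.normSq_eq_norm_sq, Complex.real_smul]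
      push_cast
      ring
    simp_rw [e]
    rw [integral_complex_ofReal, integral_const_mul, h2]
    have h3 : ((2 * a : ℕ) + 2 : ℝ) / 2 = (a : ℝ) + 1 := by push_cast; ring
    rw [h3, Real.Gamma_nat_eq_factorial, ← Complex.ofReal_natCast]
    congr 1
    field_simp
  · set g : ℂ → ℂ := fun z => (Real.pi⁻¹ * Real.exp (-‖z‖ ^ 2)) • (z ^ a * conj z ^ b) with hg
    have hab' : (a : ℂ) - b ≠ 0 := sub_ne_zero.2 (by exact_mod_cast hab)
    -- The rotation by this angle multiplies `z ^ a * conj z ^ b` by `exp (iπ) = -1`; rotation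
    -- invariance then forces the integral to vanish.
    let θ : ℝ := Real.pi / ((a : ℝ) - b)
    let ω : Circle := Circle.exp θ
    have hω : (ω : ℂ) ^ a * conj (ω : ℂ) ^ b = -1 := by
      simp only [ω, Circle.coe_exp]
      rw [← Complex.exp_conj, ← Complex.exp_nat_mul, ← Complex.exp_nat_mul, ← Complex.exp_add,
        ← Complex.exp_pi_mul_I]
      congr 1
      simp only [θ, map_mul, Complex.conj_ofReal, Complex.conj_I]
      push_cast
      field_simp
      ring
    have h1 : ∀ z, g (rotation ω z) = - g z := fun z => by
      simp only [hg, rotation_apply, norm_mul, Circle.norm_coe, one_mul, map_mul, mul_pow]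
      rw [show (ω : ℂ) ^ a * z ^ a * (conj (ω : ℂ) ^ b * conj z ^ b) =
        ((ω : ℂ) ^ a * conj (ω : ℂ) ^ b) * (z ^ a * conj z ^ b) by ring, hω]
      simp
    have h2 : ∫ z, g (rotation ω z) = ∫ z, g z :=
      (rotation ω).measurePreserving.integral_comp
        (rotation ω).toHomeomorph.measurableEmbedding g
    simp_rw [h1, integral_neg] at h2
    exact self_eq_neg.1 h2.symm

end Moments

/-! ### The Wick formula -/

section Wick

open scoped ComplexConjugate

variable {ι κ : Type*} [Fintype ι] [Fintype κ]

open Classical in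
-- One solution `σ₀` makes the solutions a coset of the stabilizer of `k`, a product of symmetric
-- groups on the fibres. The factors are exactly the moments `E[z ^ a * conj z ^ b]`.
theorem card_perm_comp_eq (k l : ι → κ) :
    Fintype.card {σ : Equiv.Perm ι // k ∘ σ = l} =
      ∏ x, if (Finset.univ.filter (k · = x)).card = (Finset.univ.filter (l · = x)).card
        then ((Finset.univ.filter (k · = x)).card).factorial else 0 := by
  by_cases h : ∀ x, (Finset.univ.filter (k · = x)).card = (Finset.univ.filter (l · = x)).card
  · have e : ∀ x, Nonempty ({i // l i = x} ≃ {i // k i = x}) := fun x =>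
      ⟨Fintype.equivOfCardEq (by rw [Fintype.card_subtype, Fintype.card_subtype, h])⟩
    let σ₀ : Equiv.Perm ι := Equiv.ofFiberEquiv fun x => (e x).some
    have hσ₀ : k ∘ σ₀ = l := funext fun i => Equiv.ofFiberEquiv_map _ i
    simp only [h, if_true]
    have hst := DomMulAct.stabilizer_card k
    simp only [Fintype.card_subtype (fun i => k i = _), h] at hst
    rw [← hst]
    refine Fintype.card_congr (Equiv.subtypeEquiv (Equiv.mulRight σ₀⁻¹) fun σ => ?_)
    rw [Equiv.coe_mulRight, Equiv.Perm.coe_mul, ← Function.comp_assoc]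
    constructor
    · intro h1
      rw [h1, ← hσ₀]
      ext i; simp
    · intro h1
      conv_rhs => rw [← hσ₀, ← h1]
      ext i; simp
  · obtain ⟨x, hx⟩ := not_forall.1 h
    rw [Finset.prod_eq_zero (Finset.mem_univ x) (if_neg hx), Fintype.card_eq_zero_iff]
    refine ⟨fun σ => hx ?_⟩
    refine (Finset.card_equiv σ.1 fun i => ?_).symm
    have := congrFun σ.2 i
    simp only [Function.comp_apply] at this
    simp [this]

variable {Ω : Type*} [MeasurableSpace Ω] {μ : Measure Ω} {X : κ → Ω → ℂ}

open Classical in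
theorem prod_mul_conj_eq (x : κ → ℂ) (k l : ι → κ) :
    ∏ i, (x (k i) * conj (x (l i))) = ∏ y, x y ^ (Finset.univ.filter (k · = y)).card *
      conj (x y) ^ (Finset.univ.filter (l · = y)).card := by
  rw [Finset.prod_mul_distrib, Finset.prod_mul_distrib, ← Finset.prod_fiberwise' _ k x,
    ← Finset.prod_fiberwise' _ l fun y => conj (x y)]
  simp only [Finset.prod_const]

theorem IsGaussianTensor.integrable_prod [IsProbabilityMeasure μ] (hX : IsGaussianTensor X μ)
    (k l : ι → κ) :
    Integrable (fun ω => ∏ i, (X (k i) ω * conj (X (l i) ω))) μ := by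
  classical
  simp_rw [fun ω => prod_mul_conj_eq (fun y => X y ω) k l]
  have h := hX.indep.map_fun_eq_pi_map fun i => (hX.law i).aemeasurable
  have hsf : ∀ y, SigmaFinite (μ.map (X y)) := fun y => by
    have := Measure.isProbabilityMeasure_map (μ := μ) (hX.law y).aemeasurable
    infer_instance
  have h1 : Integrable (fun x : κ → ℂ => ∏ y, x y ^ (Finset.univ.filter (k · = y)).card *
      conj (x y) ^ (Finset.univ.filter (l · = y)).card) (μ.map fun ω y => X y ω) := by
    rw [h]
    refine Integrable.fintype_prod (f := fun y z => z ^ (Finset.univ.filter (k · = y)).card *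
      conj z ^ (Finset.univ.filter (l · = y)).card) fun y => ?_
    rw [(hX.law y).map_eq]
    exact integrable_pow_mul_conj_pow _ _
  exact h1.comp_aemeasurable (aemeasurable_pi_lambda _ fun y => (hX.law y).aemeasurable)

open Classical in
/-- The Wick formula. -/
theorem IsGaussianTensor.integral_prod (hX : IsGaussianTensor X μ) (k l : ι → κ) :
    ∫ ω, ∏ i, (X (k i) ω * conj (X (l i) ω)) ∂μ =
      (Fintype.card {σ : Equiv.Perm ι // k ∘ σ = l} : ℂ) := by
  simp_rw [fun ω => prod_mul_conj_eq (fun y => X y ω) k l]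
  rw [hX.indep.integral_fun_prod_comp (f := fun y z => z ^ (Finset.univ.filter (k · = y)).card *
      conj z ^ (Finset.univ.filter (l · = y)).card) (fun i => (hX.law i).aemeasurable)
      fun i => Continuous.aestronglyMeasurable (by fun_prop)]
  rw [card_perm_comp_eq, Nat.cast_prod]
  refine Finset.prod_congr rfl fun y _ => ?_
  rw [← integral_map (f := fun z => z ^ (Finset.univ.filter (k · = y)).card *
      conj z ^ (Finset.univ.filter (l · = y)).card) (hX.law y).aemeasurable
      (Continuous.aestronglyMeasurable (by fun_prop)), (hX.law y).map_eq,
    integral_pow_mul_conj_pow]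
  split_ifs <;> simp

end Wick

/-! ### Expected traces as sums over pairings -/

section TraceExpansion

variable {ι R : Type*} [Fintype ι] [DecidableEq ι] [CommSemiring R]

theorem prod_ofFn_apply {n : ℕ} (M : Fin (n + 1) → Matrix ι ι R) (x y : ι) :
    (List.ofFn M).prod x y = ∑ w : Fin n → ι,
      ∏ i, M i ((Fin.cons x w : Fin (n + 1) → ι) i) ((Fin.snoc w y : Fin (n + 1) → ι) i) := by
  induction n generalizing x with
  | zero => simp [Fin.snoc]
  | succ n ih =>
    rw [List.ofFn_succ, List.prod_cons, Matrix.mul_apply,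
      ← (Fin.consEquiv fun _ : Fin (n + 1) => ι).sum_comp, Fintype.sum_prod_type]
    refine Finset.sum_congr rfl fun z _ => ?_
    rw [ih, Finset.mul_sum]
    refine Finset.sum_congr rfl fun w _ => ?_
    rw [Fin.prod_univ_succ (n := n + 1)]
    simp only [Fin.consEquiv, Equiv.coe_fn_mk, Fin.cons_zero, Fin.cons_succ,
      ← Fin.cons_snoc_eq_snoc_cons]

theorem trace_prod_ofFn {n : ℕ} (M : Fin (n + 1) → Matrix ι ι R) :
    (List.ofFn M).prod.trace = ∑ v : Fin (n + 1) → ι, ∏ i, M i (v i) (v (finRotate _ i)) := by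
  rw [Matrix.trace, ← (Fin.consEquiv fun _ : Fin (n + 1) => ι).sum_comp, Fintype.sum_prod_type]
  refine Finset.sum_congr rfl fun x _ => ?_
  rw [Matrix.diag_apply, prod_ofFn_apply]
  refine Finset.sum_congr rfl fun w _ => ?_
  refine Finset.prod_congr rfl fun i _ => ?_
  rw [Fin.snoc_eq_cons_rotate]
  rfl

end TraceExpansion

section Expectation

open scoped ComplexConjugate

variable {A B D : Type*}

/-- The index of a tensor with coordinates `i` in the two spaces kept by the marginal `W_l` and
`s` in the two spaces traced out. -/
def tensorIndex : Letter → A × B → B × D → A × B × B × D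
  | Letter.AB, i, s => (i.1, i.2, s.1, s.2)
  | Letter.AC, i, s => (i.1, s.1, i.2, s.2)

theorem W_apply [Fintype B] [Fintype D] (X : A × B × B × D → ℂ) (l : Letter) (i j : A × B) :
    W X l i j = ∑ s : B × D, X (tensorIndex l i s) * conj (X (tensorIndex l j s)) := by
  cases l <;>
    simp [W, marginalAB, marginalAC, outer, Matrix.vecMulVec, tensorIndex, Fintype.sum_prod_type]

theorem trace_prod_W [Fintype A] [Fintype B] [Fintype D] [DecidableEq A] [DecidableEq B] {n : ℕ}
    (X : A × B × B × D → ℂ) (f : Fin (n + 1) → Letter) :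
    (List.ofFn fun i => W X (f i)).prod.trace =
      ∑ vs : (Fin (n + 1) → A × B) × (Fin (n + 1) → B × D),
        ∏ i, (X (tensorIndex (f i) (vs.1 i) (vs.2 i)) *
          conj (X (tensorIndex (f i) (vs.1 (finRotate _ i)) (vs.2 i)))) := by
  rw [trace_prod_ofFn, Fintype.sum_prod_type]
  refine Finset.sum_congr rfl fun v _ => ?_
  simp only [W_apply]
  rw [Finset.prod_univ_sum, Fintype.piFinset_univ]

/-- The `A` and `D` legs have the same role for both letters, while the kept and the traced leg of
size `m` exchange roles; this is the source of the crosswise joints. -/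
theorem tensorIndex_eq_iff {l l' : Letter} {i j : A × B} {s t : B × D} :
    tensorIndex l' i s = tensorIndex l j t ↔ (j.1 = i.1 ∧ s.2 = t.2) ∧
      (l ≠ l' → j.2 = s.1 ∧ t.1 = i.2) ∧ (¬ l ≠ l' → j.2 = i.2 ∧ t.1 = s.1) := by
  cases l <;> cases l' <;> simp [tensorIndex] <;> grind

/-- The number of index tuples compatible with the Wick pairing `σ` in the expansion of the
trace of a word. -/
noncomputable def pairingWeight {n : ℕ} (N D m : ℕ) (f : Fin n → Letter)
    (σ : Equiv.Perm (Fin n)) : ℕ :=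
  N ^ numCycles (σ * (finRotate n)⁻¹) * D ^ numCycles σ *
    Nat.card (strandColorings (finRotate n) σ (fun i => f i ≠ f (σ i)) (Fin m))

theorem card_invariant_mul_inv {T : Type*} [Finite T] (X : Type*) [Finite X]
    (γ σ : Equiv.Perm T) :
    Nat.card {g : T → X // ∀ i, g (γ i) = g (σ i)} = Nat.card X ^ numCycles (σ * γ⁻¹) := by
  rw [← card_invariant]
  refine Nat.card_congr (Equiv.subtypeEquivRight fun g => ⟨fun h i => ?_, fun h i => ?_⟩)
  · rw [Equiv.Perm.mul_apply, ← h]; simp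
  · simpa using (h (γ i)).symm

end Expectation

section Expectation

variable {N D m : ℕ}

theorem card_compatible {n : ℕ} (f : Fin n → Letter) (σ : Equiv.Perm (Fin n)) :
    Nat.card {vs : (Fin n → Fin N × Fin m) × (Fin n → Fin m × Fin D) //
      (fun i => tensorIndex (f i) (vs.1 i) (vs.2 i)) ∘ σ =
        fun i => tensorIndex (f i) (vs.1 (finRotate _ i)) (vs.2 i)} = pairingWeight N D m f σ := by
  have h1 := card_invariant_mul_inv (Fin N) (finRotate n) σ
  have h2 := card_invariant (Fin D) σ
  simp only [Nat.card_eq_fintype_card, Fintype.card_fin] at h1 h2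
  rw [pairingWeight, ← h1, ← h2, ← Nat.card_eq_fintype_card, ← Nat.card_eq_fintype_card,
    ← Nat.card_prod, ← Nat.card_prod]
  refine Nat.card_congr
    { toFun := fun vs => ((⟨fun i => (vs.1.1 i).1, ?_⟩, ⟨fun i => (vs.1.2 i).2, ?_⟩),
        ⟨(fun i => (vs.1.1 i).2, fun i => (vs.1.2 i).1), ?_⟩)
      invFun := fun g => ⟨(fun i => (g.1.1.1 i, g.2.1.1 i), fun i => (g.2.1.2 i, g.1.2.1 i)), ?_⟩
      left_inv := fun vs => rfl
      right_inv := fun g => rfl }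
  · exact fun i => (tensorIndex_eq_iff.1 (congrFun vs.2 i)).1.1
  · exact fun i => (tensorIndex_eq_iff.1 (congrFun vs.2 i)).1.2
  · exact fun i => (tensorIndex_eq_iff.1 (congrFun vs.2 i)).2
  · exact funext fun i => tensorIndex_eq_iff.2 ⟨⟨g.1.1.2 i, g.1.2.2 i⟩, g.2.2 i⟩

variable {Ω : Type*} [MeasurableSpace Ω] {μ : Measure Ω} [IsProbabilityMeasure μ]
  {X : Fin N × Fin m × Fin m × Fin D → Ω → ℂ}

theorem IsGaussianTensor.integrable_trace (hX : IsGaussianTensor X μ) {p : ℕ}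
    (f : Fin p → Letter) :
    Integrable (fun ω => (List.ofFn fun i => W (fun k => X k ω) (f i)).prod.trace) μ := by
  obtain _ | n := p
  · simpa using integrable_const _
  · simp_rw [trace_prod_W]
    exact integrable_finsetSum _ fun v _ => hX.integrable_prod _ _

theorem IsGaussianTensor.integral_trace (hX : IsGaussianTensor X μ) {n : ℕ}
    (f : Fin (n + 1) → Letter) :
    ∫ ω, (List.ofFn fun i => W (fun k => X k ω) (f i)).prod.trace ∂μ =
      ((∑ σ : Equiv.Perm (Fin (n + 1)), pairingWeight N D m f σ : ℕ) : ℂ) := by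
  classical
  simp_rw [trace_prod_W]
  rw [integral_finsetSum _ fun v _ => hX.integrable_prod _ _]
  simp_rw [hX.integral_prod]
  rw [← Nat.cast_sum]
  congr 1
  simp_rw [← card_compatible, Nat.card_eq_fintype_card, Fintype.card_subtype, Finset.card_filter]
  -- Pairs (index tuple, compatible pairing) are counted in the other order.
  exact Finset.sum_comm

end Expectation

/-! ### Realization of prescribed moments -/

section Functional

/-- Any prescription of the moments of a family is realized by a linear functional on a complex
algebra. -/
theorem exists_functional (L : Type) (Λ : ∀ p : ℕ, (Fin p → L) → ℂ) :
    ∃ (𝒜 : Type) (_ : Ring 𝒜) (_ : Algebra ℂ 𝒜) (φ : 𝒜 →ₗ[ℂ] ℂ) (x : L → 𝒜),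
      ∀ (p : ℕ) (f : Fin p → L), φ (List.ofFn fun i => x (f i)).prod = Λ p f := by
  -- The words form a linear basis of the free algebra, so the values on them are unconstrained.
  let φ : MonoidAlgebra ℂ (FreeMonoid L) →ₗ[ℂ] ℂ :=
    (Finsupp.linearCombination ℂ fun w : FreeMonoid L =>
      Λ (FreeMonoid.toList w).length (FreeMonoid.toList w).get) ∘ₗ
        (MonoidAlgebra.coeffLinearEquiv ℂ).toLinearMap
  refine ⟨MonoidAlgebra ℂ (FreeMonoid L), inferInstance, inferInstance, φ,
    fun l => MonoidAlgebra.of ℂ _ (FreeMonoid.of l), fun p f => ?_⟩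
  have h1 : (List.ofFn fun i => MonoidAlgebra.of ℂ _ (FreeMonoid.of (f i))).prod =
      MonoidAlgebra.of ℂ _ (FreeMonoid.ofList (List.ofFn f)) := by
    rw [show (List.ofFn fun i => MonoidAlgebra.of ℂ _ (FreeMonoid.of (f i))) =
      ((List.ofFn f).map FreeMonoid.of).map (MonoidAlgebra.of ℂ (FreeMonoid L)) by
        simp [List.map_ofFn, Function.comp_def], ← map_list_prod]
    congr 1
    generalize List.ofFn f = l
    induction l with
    | nil => rfl
    | cons a l ih => rw [List.map_cons, List.prod_cons, ih]; rfl
  have h2 : ∀ w : List L, φ (MonoidAlgebra.of ℂ _ (FreeMonoid.ofList w)) = Λ w.length w.get :=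
    fun w => by
      simp [φ, MonoidAlgebra.coeffLinearEquiv]
  have h3 : ∀ (w : List L) (hw : w.length = p),
      Λ w.length w.get = Λ p fun i => w.get (i.cast hw.symm) := by
    rintro w rfl; rfl
  rw [h1, h2, h3 _ (List.length_ofFn)]
  congr 1
  ext i
  simp

end Functional

/-! ### Uniqueness of free cumulants -/

section Cumulants

/-- The partition with one block. -/
def oneBlock {n : ℕ} (hn : 0 < n) : Finpartition (Finset.univ : Finset (Fin n)) :=
  Finpartition.indiscrete (a := (Finset.univ : Finset (Fin n)))
    (Finset.Nonempty.ne_empty ⟨⟨0, hn⟩, Finset.mem_univ _⟩)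

theorem eq_oneBlock {n : ℕ} (hn : 0 < n) {π : Finpartition (Finset.univ : Finset (Fin n))}
    (h : Finset.univ ∈ π.parts) : π = oneBlock hn := by
  refine Finpartition.ext (Finset.eq_singleton_iff_unique_mem.mpr ⟨h, fun V hV => ?_⟩)
  obtain ⟨v, hv⟩ := π.nonempty_of_mem_parts hV
  exact π.eq_of_mem_parts hV h hv (Finset.mem_univ v)

theorem oneBlock_mem_NC {n : ℕ} (hn : 0 < n) : oneBlock hn ∈ NC n := by
  classical
  refine Finset.mem_filter.mpr ⟨Finset.mem_univ _, fun V hV V' hV' => ?_⟩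
  simp only [oneBlock, Finpartition.indiscrete, Finset.mem_singleton] at hV hV'
  simp [hV, hV']

theorem orderEmbOfFin_univ {n : ℕ} (i : Fin n) :
    (Finset.univ : Finset (Fin n)).orderEmbOfFin (Finset.card_fin n) i = i :=
  (congrFun (Finset.orderEmbOfFin_unique (Finset.card_fin n) (f := id)
    (fun _ => Finset.mem_univ _) strictMono_id) i).symm

theorem prod_oneBlock {n : ℕ} (hn : 0 < n) {L : Type*} (κ : ∀ k : ℕ, (Fin k → L) → ℂ)
    (a : Fin n → L) :
    ∏ V ∈ (oneBlock hn).parts, κ V.card (fun i => a (V.orderEmbOfFin rfl i)) = κ n a := by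
  have key : ∀ (s : Finset (Fin n)) (k : ℕ) (h : s.card = k),
      (κ s.card fun i => a (s.orderEmbOfFin rfl i)) = κ k fun i => a (s.orderEmbOfFin h i) := by
    rintro s _ rfl; rfl
  simp only [oneBlock, Finpartition.indiscrete, Finset.prod_singleton]
  rw [key _ n (Finset.card_fin n)]
  simp only [orderEmbOfFin_univ]

/-- The moment-cumulant formula determines the free cumulants. -/
theorem freeCumulant_eq_of_moments {𝒜 L : Type*} [Ring 𝒜] [Algebra ℂ 𝒜] (φ : 𝒜 →ₗ[ℂ] ℂ)
    (x : L → 𝒜) (κ : ∀ k : ℕ, (Fin k → L) → ℂ)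
    (h : ∀ (p : ℕ) (f : Fin p → L), 0 < p → φ (List.ofFn fun i => x (f i)).prod =
      ∑ π ∈ NC p, ∏ V ∈ π.parts, κ V.card fun i => f (V.orderEmbOfFin rfl i))
    (p : ℕ) (hp : 0 < p) (f : Fin p → L) : freeCumulant φ p (fun i => x (f i)) = κ p f := by
  classical
  induction p using Nat.strong_induction_on with
  | _ p ih =>
    have h1 := h p f hp
    -- The one-block terms are the two cumulants of order `p`; all other partitions have only
    -- smaller blocks, where the induction hypothesis applies.
    rw [moment_cumulant φ hp, ← Finset.add_sum_erase _ _ (oneBlock_mem_NC hp),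
      ← Finset.add_sum_erase _ _ (oneBlock_mem_NC hp), prod_oneBlock hp κ] at h1
    have h2 : ∀ π : Finpartition (Finset.univ : Finset (Fin p)), ∏ V : {V // V ∈ π.parts},
        freeCumulant φ V.1.card (fun i => x (f (V.1.orderEmbOfFin rfl i))) =
        ∏ V ∈ π.parts, freeCumulant φ V.card (fun i => x (f (V.orderEmbOfFin rfl i))) :=
      fun π => Finset.prod_coe_sort π.parts
        (fun V => freeCumulant φ V.card (fun i => x (f (V.orderEmbOfFin rfl i))))
    simp_rw [h2] at h1
    rw [prod_oneBlock hp (fun k a => freeCumulant φ k fun i => x (a i))] at h1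
    refine add_right_cancel (h1.trans (congrArg _ (Finset.sum_congr rfl fun π hπ => ?_)))
    refine Finset.prod_congr rfl fun V hV => ?_
    have hne : V ≠ Finset.univ := by
      rintro rfl
      exact (Finset.mem_erase.1 hπ).1 (eq_oneBlock hp hV)
    refine (ih V.card ?_ (Finset.card_pos.2 (π.nonempty_of_mem_parts hV)) _).symm
    simpa using Finset.card_lt_card (Finset.ssubset_univ_iff.mpr hne)

end Cumulants

/-! ### The limit of the normalized moments -/

section Limit

/-- The limit of the normalized moment of a word. -/
noncomputable def limitMoment (c : ℝ) (m : ℕ) {p : ℕ} (f : Fin p → Letter) : ℂ :=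
  ∑ α ∈ NC p, (c : ℂ) ^ α.parts.card * (m : ℂ) ^ (-(altNC f α : ℤ))

theorem limitMoment_eq_sum_prod (c : ℝ) (m : ℕ) {p : ℕ} (f : Fin p → Letter) :
    limitMoment c m f = ∑ π ∈ NC p, ∏ V ∈ π.parts,
      ((c : ℂ) * (m : ℂ) ^ (-(alt (fun i => f (V.orderEmbOfFin rfl i)) : ℤ))) := by
  refine Finset.sum_congr rfl fun π _ => ?_
  rw [Finset.prod_mul_distrib, Finset.prod_const, altNC_eq_sum]
  simp only [zpow_neg, zpow_natCast]
  rw [Finset.prod_inv_distrib, Finset.prod_pow_eq_pow_sum]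

open Classical in
theorem limitMoment_eq_sum_perm (c : ℝ) (m : ℕ) {p : ℕ} (f : Fin p → Letter) :
    limitMoment c m f = ∑ σ : Equiv.Perm (Fin p) with IsNoncrossingPerm σ,
      (c : ℂ) ^ numCycles σ * (m : ℂ) ^ (-({a | f a ≠ f (σ a)}.ncard : ℤ)) := by
  rw [← sum_NC_eq_sum_perm]
  simp only [limitMoment, numCycles_blockPerm, altNC_eq_ncard]

theorem conj_limitMoment (c : ℝ) (m : ℕ) {p : ℕ} (f : Fin p → Letter) :
    starRingEnd ℂ (limitMoment c m f) = limitMoment c m f := by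
  simp [limitMoment, map_sum]

theorem limitMoment_ne_zero {c : ℝ} (hc : 0 < c) {m : ℕ} (hm : 0 < m) {p : ℕ}
    (f : Fin p → Letter) : limitMoment c m f ≠ 0 := by
  classical
  have h : limitMoment c m f = ((∑ σ : Equiv.Perm (Fin p) with IsNoncrossingPerm σ,
      c ^ numCycles σ * (m : ℝ) ^ (-({a | f a ≠ f (σ a)}.ncard : ℤ)) : ℝ) : ℂ) := by
    rw [limitMoment_eq_sum_perm]
    push_cast
    rfl
  rw [h, Complex.ofReal_ne_zero]
  refine (Finset.sum_pos (fun σ _ => by positivity) ⟨1, ?_⟩).ne'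
  simp only [Finset.mem_filter, Finset.mem_univ, true_and]
  exact fun i j hij => hij

theorem limitMoment_zero (c : ℝ) (m : ℕ) (f : Fin 0 → Letter) : limitMoment c m f = 1 := by
  classical
  have h1 : (Finset.univ.filter fun σ : Equiv.Perm (Fin 0) => IsNoncrossingPerm σ) = {1} := by
    ext σ
    simp only [Finset.mem_filter, Finset.mem_univ, true_and, Finset.mem_singleton,
      Subsingleton.elim σ 1, iff_true]
    exact fun i => i.elim0
  have h2 : numCycles (1 : Equiv.Perm (Fin 0)) = 0 := by
    rw [numCycles, Nat.card_eq_zero]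
    exact Or.inl ⟨fun q => q.inductionOn fun i => i.elim0⟩
  rw [limitMoment_eq_sum_perm, h1, Finset.sum_singleton, h2]
  simp [Set.eq_empty_of_isEmpty]

variable {m : ℕ} {c : ℝ} {D : ℕ → ℕ}

open Classical in
theorem tendsto_pairingWeight (hm : 0 < m) (hD : Tendsto (fun N => (D N : ℝ) / N) atTop (𝓝 c))
    {n : ℕ} (f : Fin (n + 1) → Letter) (σ : Equiv.Perm (Fin (n + 1))) :
    Tendsto (fun N : ℕ => (pairingWeight N (D N) m f σ : ℂ) / ((m : ℂ) * N) ^ (n + 2)) atTop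
      (𝓝 (if IsNoncrossingPerm σ then
        (c : ℂ) ^ numCycles σ * (m : ℂ) ^ (-({a | f a ≠ f (σ a)}.ncard : ℤ)) else 0)) := by
  obtain ⟨h1, h2, h3⟩ := genus_induction n (Fin (n + 1)) (finRotate _) σ (by simp)
    (isCyclicSucc_finRotate _)
  have hm' : (m : ℂ) ≠ 0 := by exact_mod_cast hm.ne'
  set x := numCycles (σ * (finRotate (n + 1))⁻¹) with hx
  set y := numCycles σ with hy
  set K := Nat.card (strandColorings (finRotate (n + 1)) σ (fun i => f i ≠ f (σ i)) (Fin m))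
    with hK
  have hDC : Tendsto (fun N => (D N : ℂ) / N) atTop (𝓝 (c : ℂ)) := by
    simpa using hD.ofReal
  -- The exponent of `N⁻¹` is the defect in the genus inequality. The convention `0 ^ 0 = 1` keeps
  -- exactly the non-crossing terms in the limit.
  have hlim : Tendsto (fun N : ℕ => ((D N : ℂ) / N) ^ y * (K / (m : ℂ) ^ (n + 2)) *
      ((N : ℂ)⁻¹) ^ (n + 2 - (y + x))) atTop
      (𝓝 ((c : ℂ) ^ y * (K / (m : ℂ) ^ (n + 2)) * 0 ^ (n + 2 - (y + x)))) :=
    ((hDC.pow y).mul_const _).mul ((tendsto_inv_atTop_nhds_zero_nat (𝕜 := ℂ)).pow _)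
  have hval : (if IsNoncrossingPerm σ then
        (c : ℂ) ^ y * (m : ℂ) ^ (-({a | f a ≠ f (σ a)}.ncard : ℤ)) else 0) =
      (c : ℂ) ^ y * (K / (m : ℂ) ^ (n + 2)) * 0 ^ (n + 2 - (y + x)) := by
    split_ifs with hσ
    · rw [h2.2 hσ, Nat.sub_self, pow_zero, mul_one]
      have h4 := h3 hσ (fun i => f i ≠ f (σ i)) (Fin m)
      rw [← hK, Nat.card_eq_fintype_card, Fintype.card_fin] at h4
      have h5 : (K : ℂ) * (m : ℂ) ^ {a | f a ≠ f (σ a)}.ncard = (m : ℂ) ^ (n + 2) := by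
        exact_mod_cast h4
      rw [← h5, zpow_neg, zpow_natCast]
      have hK0 : (K : ℂ) ≠ 0 := fun h => by
        rw [h, zero_mul] at h5
        exact pow_ne_zero _ hm' h5.symm
      field_simp
    · rw [zero_pow, mul_zero]
      have := mt h2.1 hσ
      omega
  rw [hval]
  refine hlim.congr' ((eventually_gt_atTop 0).mono fun N hN => ?_)
  have hN' : (N : ℂ) ≠ 0 := by exact_mod_cast hN.ne'
  obtain ⟨d, hd⟩ := Nat.exists_eq_add_of_le h1
  have hd' : n + 2 - (y + x) = d := by omega
  simp only [pairingWeight, ← hx, ← hy, ← hK, hd']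
  push_cast
  rw [mul_pow, inv_pow, div_pow, show (N : ℂ) ^ (n + 2) = N ^ y * N ^ x * N ^ d by
    rw [hd, pow_add, pow_add]]
  field_simp

variable {Ω : ℕ → Type*} [∀ N, MeasurableSpace (Ω N)] {μ : ∀ N, Measure (Ω N)}
  [∀ N, IsProbabilityMeasure (μ N)] {X : ∀ N, Fin N × Fin m × Fin m × Fin (D N) → Ω N → ℂ}

theorem tendsto_integral_trace (hm : 0 < m)
    (hD : Tendsto (fun N => (D N : ℝ) / N) atTop (𝓝 c))
    (hX : ∀ N, IsGaussianTensor (X N) (μ N)) {p : ℕ} (f : Fin p → Letter) :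
    Tendsto (fun N : ℕ => (∫ ω, (List.ofFn fun i => W (fun k => X N k ω) (f i)).prod.trace ∂(μ N)) /
      ((m : ℂ) * N) ^ (p + 1)) atTop (𝓝 (limitMoment c m f)) := by
  classical
  -- The pairing expansion needs a nonempty word. For the empty word the trace is the dimension, and
  -- the quotient is `1` once `N > 0`.
  obtain _ | n := p
  · rw [limitMoment_zero]
    refine tendsto_const_nhds.congr' ((eventually_gt_atTop 0).mono fun N hN => ?_)
    have hN' : (N : ℂ) ≠ 0 := by exact_mod_cast hN.ne'
    have hm' : (m : ℂ) ≠ 0 := by exact_mod_cast hm.ne'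
    simp
    field_simp
  · simp_rw [fun N => (hX N).integral_trace f]
    push_cast
    simp_rw [Finset.sum_div]
    rw [limitMoment_eq_sum_perm, Finset.sum_filter]
    exact tendsto_finsetSum _ fun σ _ => tendsto_pairingWeight hm hD f σ

end Limit

/-! ### Reversed words and rescaling -/

section Words

theorem conjTranspose_W {A B D : Type*} [Fintype B] [Fintype D] (X : A × B × B × D → ℂ)
    (l : Letter) : (W X l).conjTranspose = W X l := by
  ext i j
  simp [Matrix.conjTranspose_apply, W_apply, mul_comm]

/-- The marginals are self-adjoint, so reversing a word takes the adjoint of the product. The limit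
moments are real, hence unaffected by the order convention. -/
theorem trace_wordW {A B D : Type*} [Fintype A] [Fintype B] [Fintype D] [DecidableEq A]
    [DecidableEq B] (X : A × B × B × D → ℂ) {p : ℕ} (f : Fin p → Letter) :
    (wordW X f).trace = starRingEnd ℂ (List.ofFn fun i => W X (f i)).prod.trace := by
  have h : (List.ofFn fun i => W X (f i)).map Matrix.conjTranspose =
      List.ofFn fun i => W X (f i) := by
    simp [List.map_ofFn, Function.comp_def, conjTranspose_W]
  rw [starRingEnd_apply, ← Matrix.trace_conjTranspose, Matrix.conjTranspose_list_prod, h, wordW]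

theorem prod_ofFn_smul {𝒜 : Type*} [Ring 𝒜] [Algebra ℂ 𝒜] (r : ℂ) {p : ℕ} (a : Fin p → 𝒜) :
    (List.ofFn fun i => r • a i).prod = r ^ p • (List.ofFn a).prod := by
  induction p with
  | zero => simp
  | succ p ih =>
    rw [List.ofFn_succ, List.prod_cons, ih (fun i => a i.succ), List.ofFn_succ, List.prod_cons,
      smul_mul_smul_comm, pow_succ']

end Words

end WishartTensor

/-! ### The main theorem -/

theorem mainTheorem2 (m : ℕ) (hm : 0 < m) (c : ℝ) (hc : 0 < c)
    (D : ℕ → ℕ) (hD : Tendsto (fun N => (D N : ℝ) / N) atTop (𝓝 c))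
    {Ω : ℕ → Type*} [∀ N, MeasurableSpace (Ω N)]
    (μ : ∀ N, Measure (Ω N)) [∀ N, IsProbabilityMeasure (μ N)]
    (X : ∀ N, Fin N × Fin m × Fin m × Fin (D N) → Ω N → ℂ)
    (hX : ∀ N, WishartTensor.IsGaussianTensor (X N) (μ N)) :
    -- convergence in distribution of the rescaled pair, and free cumulants of the limit
    (∃ (𝒜 : Type) (_ : Ring 𝒜) (_ : Algebra ℂ 𝒜) (φ : 𝒜 →ₗ[ℂ] ℂ)
        (x : WishartTensor.Letter → 𝒜),
      φ 1 = 1 ∧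
      WishartTensor.ConvergesInDistribution (ι := fun N => Fin N × Fin m) μ
        (fun N l ω => ((m : ℂ) * (N : ℂ))⁻¹ • WishartTensor.W (fun k => X N k ω) l) φ x ∧
      ∀ (p : ℕ), 0 < p → ∀ f : Fin p → WishartTensor.Letter,
        WishartTensor.freeCumulant φ p (fun i => x (f i)) =
          (c : ℂ) * (m : ℂ) ^ (-(WishartTensor.alt f : ℤ))) ∧
    -- asymptotics of the mixed moments
    (∀ (p : ℕ) (f : Fin p → WishartTensor.Letter),
      (∀ N, Integrable
        (fun ω => (WishartTensor.wordW (fun k => X N k ω) f).trace) (μ N)) ∧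
      (fun N : ℕ => ∫ ω, (WishartTensor.wordW (fun k => X N k ω) f).trace ∂(μ N)) ~[atTop]
        (fun N : ℕ => ((m : ℂ) * (N : ℂ)) ^ (p + 1) *
          ∑ α ∈ WishartTensor.NC p,
            (c : ℂ) ^ α.parts.card * (m : ℂ) ^ (-(WishartTensor.altNC f α : ℤ)))) := by
  constructor
  · obtain ⟨𝒜, i1, i2, φ, x, hφ⟩ := WishartTensor.exists_functional WishartTensor.Letter
      fun _ f => WishartTensor.limitMoment c m f
    refine ⟨𝒜, i1, i2, φ, x, ?_, fun p f => ⟨fun N => ?_, ?_⟩, ?_⟩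
    · simpa [WishartTensor.limitMoment_zero] using hφ 0 Fin.elim0
    · simp only [WishartTensor.prod_ofFn_smul, Matrix.trace_smul, smul_eq_mul]
      exact ((hX N).integrable_trace f).const_mul _
    · rw [hφ]
      refine (WishartTensor.tendsto_integral_trace hm hD hX f).congr fun N => ?_
      simp only [WishartTensor.prod_ofFn_smul, Matrix.trace_smul, smul_eq_mul]
      -- Of the `p + 1` factors `(mN)⁻¹`, `p` come from the rescaled matrices and one from the
      -- normalized trace.
      rw [integral_const_mul, integral_const_mul, Fintype.card_prod, Fintype.card_fin,
        Fintype.card_fin, div_eq_mul_inv, pow_succ, mul_inv, inv_pow]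
      push_cast
      rw [mul_comm (N : ℂ)]
      ring
    · refine WishartTensor.freeCumulant_eq_of_moments φ x
        (fun p f => (c : ℂ) * (m : ℂ) ^ (-(WishartTensor.alt f : ℤ))) fun p f _ => ?_
      rw [hφ, WishartTensor.limitMoment_eq_sum_prod]
  · intro p f
    simp only [WishartTensor.trace_wordW]
    refine ⟨fun N => ?_, ?_⟩
    · exact Complex.conjLIE.integrable_comp_iff.2 ((hX N).integrable_trace f)
    -- The equivalence is proved as a ratio tending to `1`, which requires the limit to be nonzero:
    -- it is a sum of positive terms, the identity permutation being among them.
    · have hL := WishartTensor.limitMoment_ne_zero hc hm f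
      have h := (((Complex.continuous_conj.tendsto _).comp
        (WishartTensor.tendsto_integral_trace hm hD hX f)).div_const
          (WishartTensor.limitMoment c m f))
      rw [WishartTensor.conj_limitMoment, div_self hL] at h
      refine isEquivalent_of_tendsto_one (h.congr fun N => ?_)
      simp only [Function.comp_apply, Pi.div_apply, integral_conj, map_div₀, map_pow, map_mul,
        Complex.conj_natCast]
      rw [div_div]
      rfl
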